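/- Let $r=|x|$ and $\tilde x^i=x^i/r$ on $\mathbb R^3\setminus\{0\}$, and let $f=r^{1/3}\,\tilde x^1(\tilde x^2)^3$. Consider the hypersurface $t=f$ in Minkowski spacetime $(\mathbb R\times\mathbb R^3,\,-dt^2+|dx|^2)$, understood outside a compact set (near the origin $f$ is neither smooth nor is its graph spacelike). That is, let $\Omega$ be $\mathbb R^3$ or the exterior $\{|x|>R\}$ of a closed ball ($R\ge 0$), and let $F:\Omega\to\mathbb R$ be any smooth function with spacelike graph such that $F=f$ outside a bounded set. Such $F$ exist with $\Omega=\mathbb R^3$, and $F=f$ itself is admissible on $\{|x|>R\}$ for some $R>0$. Let $g$ be the induced metric of the graph $t=F$, $k$ its second fundamental form with respect to the future unit normal (so $k_{ij}=\partial_i\partial_jF/\sqrt{1-|\nabla F|^2}$ in the coordinates $x$), and $\pi=k-(\operatorname{tr}_gk)g$. Then $(\Omega,g,k)$ is asymptotically flat in the coordinates $x$: for some $q>\tfrac12$, $p>\tfrac32$, $\epsilon>0$, $$g_{ij}-\delta_{ij}=O_2(r^{-q}),\qquad k_{ij}=O_1(r^{-p}),\qquad \mu=O(r^{-3-\epsilon}),\qquad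 |J|_g=O(r^{-3-\epsilon}),$$ where $\mu=\tfrac12\big(R_g-|k|_g^2+(\operatorname{tr}_gk)^2\big)$, $J=\operatorname{div}_gk-d(\operatorname{tr}_gk)$, and $O_l(r^{a})$ means that for each $m\le l$ the derivatives of order $m$ are $O(r^{a-m})$. Moreover the following limits exist (with $d\sigma_0$ the area measure of the round sphere of radius $r$): 1. The ADM energy, the ADM linear momentum and the center of mass integral all vanish: for all $i$, $$E=\frac1{16\pi}\lim_{r\to\infty}\int_{|x|=r}\sum_{j,k}(\partial_kg_{jk}-\partial_jg_{kk})\frac{x^j}{|x|}\,d\sigma_0=0,\qquad P_i=\frac1{8\pi}\lim_{r\to\infty}\int_{|x|=r}\sum_j\pi_{ij}\frac{x^j}{|x|}\,d\sigma_0=0,$$ $$C^i=\frac1{16\pi}\lim_{r\to\infty}\int_{|x|=r}\Big[x^i\sum_{j,k}(\partial_kg_{jk}-\partial_jg_{kk})\frac{x^j}{|x|}-\sum_k\Big((g_{ki}-\delta_{ki})\frac{x^k}{|x|}-(g_{kk}-\delta_{kk})\frac{x^i}{|x|}\Big)\Big]d\sigma_0=0.$$ 2. For every rotation field $Y(x)=a\times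 x$, $a\in\mathbb R^3$, the ADM angular momentum $$J(Y)=\frac1{8\pi}\lim_{r\to\infty}\int_{|x|=r}\sum_{j,k}\pi_{jk}Y^j\frac{x^k}{|x|}\,d\sigma_0$$ exists and is finite, and $$J\Big(x^1\frac{\partial}{\partial x^2}-x^2\frac{\partial}{\partial x^1}\Big)=\frac{2}{3\cdot7\cdot11}\neq 0 .$$ -/

import Mathlib

open Filter Topology MeasureTheory Set
open scoped ContDiff

/-- Euclidean three-space with coordinates `x 0, x 1, x 2`
(usually written x¹, x², x³). -/
abbrev E3 : Type := EuclideanSpace ℝ (Fin 3)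

noncomputable section

/-- A field of `(0,2)`-tensors on (a region of) `ℝ³`, given by its coordinate components. -/
abbrev TensorField2 : Type := E3 → Matrix (Fin 3) (Fin 3) ℝ

/-- The coordinate partial derivative `∂ᵢ u`. -/
def pd {V : Type*} [NormedAddCommGroup V] [NormedSpace ℝ V] (i : Fin 3) (u : E3 → V) (x : E3) : V :=
  fderiv ℝ u x (EuclideanSpace.single i 1)

/-! ### Curvature and constraint quantities of a metric `g` and a symmetric tensor `k` -/

/-- Christoffel symbols `Γˡᵢⱼ` of the metric `g`. -/
def christoffel (g : TensorField2) (l i j : Fin 3) (x : E3) : ℝ :=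
  1 / 2 * ∑ m, (g x)⁻¹ l m *
    (pd i (fun y => g y m j) x + pd j (fun y => g y m i) x - pd m (fun y => g y i j) x)

/-- Ricci curvature, with the sign for which round spheres have positive curvature. -/
def ricciCurvature (g : TensorField2) (i j : Fin 3) (x : E3) : ℝ :=
  ∑ l, (pd l (christoffel g l i j) x - pd j (christoffel g l i l) x
    + ∑ m, (christoffel g l l m x * christoffel g m i j x
      - christoffel g l j m x * christoffel g m i l x))

/-- Scalar curvature `R_g`. -/
def scalarCurvature (g : TensorField2) (x : E3) : ℝ :=
  ∑ i, ∑ j, (g x)⁻¹ i j * ricciCurvature g i j x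

/-- The trace `tr_g k`. -/
def metricTrace (g k : TensorField2) (x : E3) : ℝ :=
  ∑ i, ∑ j, (g x)⁻¹ i j * k x i j

/-- The squared norm `|k|²_g`. -/
def metricNormSq (g k : TensorField2) (x : E3) : ℝ :=
  ∑ i, ∑ j, ∑ a, ∑ b, (g x)⁻¹ i a * (g x)⁻¹ j b * k x i j * k x a b

/-- The covariant derivative `(∇ₗ k)ᵢⱼ`. -/
def covDeriv (g k : TensorField2) (l i j : Fin 3) (x : E3) : ℝ :=
  pd l (fun y => k y i j) x
    - ∑ m, (christoffel g m l i x * k x m j + christoffel g m l j x * k x i m)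

/-- The mass density `μ = (R_g - |k|²_g + (tr_g k)²) / 2`. -/
def massDensity (g k : TensorField2) (x : E3) : ℝ :=
  1 / 2 * (scalarCurvature g x - metricNormSq g k x + metricTrace g k x ^ 2)

/-- The current density one-form `J = div_g k - d (tr_g k)`. -/
def currentDensity (g k : TensorField2) (j : Fin 3) (x : E3) : ℝ :=
  (∑ l, ∑ i, (g x)⁻¹ l i * covDeriv g k l i j x) - pd j (metricTrace g k) x

/-- The norm `|J|_g` of the current density. -/
def currentDensityNorm (g k : TensorField2) (x : E3) : ℝ :=
  Real.sqrt (∑ i, ∑ j, (g x)⁻¹ i j * currentDensity g k i x * currentDensity g k j x)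

/-- The conjugate momentum `π = k - (tr_g k) g`. -/
def conjugateMomentum (g k : TensorField2) : TensorField2 :=
  fun x => k x - metricTrace g k x • g x

/-! ### Asymptotic flatness -/

/-- `u = O_l(r^a)` as `r = |x| → ∞`: for each `m ≤ l` the derivatives of order `m`
are `O(r^(a - m))`. -/
def IsBigOWithDerivs (l : ℕ) (u : E3 → ℝ) (a : ℝ) : Prop :=
  ∀ m : ℕ, m ≤ l →
    (fun x => ‖iteratedFDeriv ℝ m u x‖) =O[Bornology.cobounded E3] fun x => ‖x‖ ^ (a - m)

/-- `(Ω, g, k)` is an initial data set: `Ω ⊆ ℝ³` is open, `g` is a smooth Riemannian metric on `Ω`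
and `k` a smooth symmetric `(0,2)`-tensor on `Ω`. -/
structure IsInitialDataSet (Ω : Set E3) (g k : TensorField2) : Prop where
  isOpen : IsOpen Ω
  smooth_g : ∀ i j, ContDiffOn ℝ ∞ (fun x => g x i j) Ω
  smooth_k : ∀ i j, ContDiffOn ℝ ∞ (fun x => k x i j) Ω
  posDef : ∀ x ∈ Ω, (g x).PosDef
  symm : ∀ x ∈ Ω, (k x).IsSymm

/-- The initial data set `(Ω, g, k)` is asymptotically flat with one end, and the coordinates
`x` of `ℝ³` are asymptotically flat coordinates on that end: outside a compact `K ⊆ Ω` it is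
(connected and) the complement of a compact set of `ℝ³`, and there the decay conditions
on `g`, `k`, `μ` and `J` hold in the coordinates `x`. -/
def IsAsymptoticallyFlat (Ω : Set E3) (g k : TensorField2) : Prop :=
  IsInitialDataSet Ω g k ∧
  (∃ K ⊆ Ω, IsCompact K ∧ IsCompact (Ω \ K)ᶜ ∧ IsConnected (Ω \ K)) ∧
  ∃ q p ε : ℝ, 1 / 2 < q ∧ 3 / 2 < p ∧ 0 < ε ∧
    (∀ i j, IsBigOWithDerivs 2 (fun x => g x i j - if i = j then 1 else 0) (-q)) ∧
    (∀ i j, IsBigOWithDerivs 1 (fun x => k x i j) (-p)) ∧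
    massDensity g k =O[Bornology.cobounded E3] (fun x => ‖x‖ ^ (-3 - ε)) ∧
    currentDensityNorm g k =O[Bornology.cobounded E3] (fun x => ‖x‖ ^ (-3 - ε))

/-! ### ADM quantities -/

/-- `∫_{|x| = r} h dσ₀`, with `dσ₀` the area measure of the round sphere of radius `r`:
`r²` times the integral of `v ↦ h (r v)` for the area measure (of total mass `4π`)
of the unit sphere. -/
def sphereIntegral (r : ℝ) (h : E3 → ℝ) : ℝ :=
  r ^ 2 * ∫ v : Metric.sphere (0 : E3) 1, h (r • (v : E3)) ∂((volume : Measure E3).toSphere)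

/-- The ADM energy exists and equals `e`:
`E = (1/16π) lim ∫_{|x|=r} ∑ (∂ₖ gⱼₖ - ∂ⱼ gₖₖ) xʲ/|x| dσ₀`. -/
def HasADMEnergy (g : TensorField2) (e : ℝ) : Prop :=
  Tendsto (fun r : ℝ => 1 / (16 * Real.pi) * sphereIntegral r fun x =>
    ∑ j, ∑ k, (pd k (fun y => g y j k) x - pd j (fun y => g y k k) x) * (x j / ‖x‖))
    atTop (𝓝 e)

/-- The `i`-th component of the ADM linear momentum exists and equals `P`:
`Pᵢ = (1/8π) lim ∫_{|x|=r} ∑ πᵢⱼ xʲ/|x| dσ₀`. -/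
def HasADMMomentum (g k : TensorField2) (i : Fin 3) (P : ℝ) : Prop :=
  Tendsto (fun r : ℝ => 1 / (8 * Real.pi) * sphereIntegral r fun x =>
    ∑ j, conjugateMomentum g k x i j * (x j / ‖x‖))
    atTop (𝓝 P)

/-- The `i`-th component of the (unnormalized) center of mass integral
exists and equals `C`. -/
def HasCenterOfMass (g : TensorField2) (i : Fin 3) (C : ℝ) : Prop :=
  Tendsto (fun r : ℝ => 1 / (16 * Real.pi) * sphereIntegral r fun x =>
    x i * (∑ j, ∑ k, (pd k (fun y => g y j k) x - pd j (fun y => g y k k) x) * (x j / ‖x‖))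
    - ∑ k, ((g x k i - if k = i then 1 else 0) * (x k / ‖x‖) - (g x k k - 1) * (x i / ‖x‖)))
    atTop (𝓝 C)

/-- The ADM angular momentum with respect to the vector field `Y` exists (as a finite limit)
and equals `J`: `J(Y) = (1/8π) lim ∫_{|x|=r} ∑ πⱼₖ Yʲ xᵏ/|x| dσ₀`. -/
def HasADMAngularMomentum (g k : TensorField2) (Y : E3 → E3) (J : ℝ) : Prop :=
  Tendsto (fun r : ℝ => 1 / (8 * Real.pi) * sphereIntegral r fun x =>
    ∑ j, ∑ l, conjugateMomentum g k x j l * Y x j * (x l / ‖x‖))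
    atTop (𝓝 J)

/-- The rotation vector field `Y(x) = a × x` about the axis `a`. -/
def rotationField (a x : E3) : E3 :=
  !₂[a 1 * x 2 - a 2 * x 1, a 2 * x 0 - a 0 * x 2, a 0 * x 1 - a 1 * x 0]

/-! ### Graphs in Minkowski spacetime -/

/-- The Minkowski metric `-dt² + |dx|²` on `ℝ × ℝ³`. -/
def minkowski (v w : ℝ × E3) : ℝ := -(v.1 * w.1) + inner ℝ v.2 w.2

/-- The parametrization `x ↦ (F x, x)` of the graph `t = F`. -/
def graphMap (F : E3 → ℝ) (x : E3) : ℝ × E3 := (F x, x)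

/-- The metric induced on the graph `t = F`, in the coordinates `x`. -/
def inducedMetric (F : E3 → ℝ) : TensorField2 :=
  fun x => Matrix.of fun i j => minkowski (pd i (graphMap F) x) (pd j (graphMap F) x)

/-- The future-directed timelike unit normal of the graph `t = F`. -/
def unitNormal (F : E3 → ℝ) (x : E3) : ℝ × E3 :=
  (1 / Real.sqrt (1 - ‖gradient F x‖ ^ 2)) • ((1, gradient F x) : ℝ × E3)

/-- The second fundamental form of the graph `t = F` for the future-directed unit normal `n`,
in the coordinates `x`: `k(∂ᵢ, ∂ⱼ) = ⟨D_{∂ᵢ} n, ∂ⱼ⟩ = -⟨n, D_{∂ᵢ} ∂ⱼ⟩`. -/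
def secondFundamentalForm (F : E3 → ℝ) : TensorField2 :=
  fun x => Matrix.of fun i j => -minkowski (unitNormal F x) (pd i (pd j (graphMap F)) x)

/-- The graph `t = F` over `Ω` is a smooth spacelike hypersurface. -/
structure IsSpacelikeGraph (Ω : Set E3) (F : E3 → ℝ) : Prop where
  isOpen : IsOpen Ω
  smooth : ContDiffOn ℝ ∞ F Ω
  spacelike : ∀ x ∈ Ω, (inducedMetric F x).PosDef

/-- `Ω` is all of `ℝ³` or the exterior of a closed ball centered at the origin. -/
def IsExteriorRegion (Ω : Set E3) : Prop :=
  Ω = univ ∨ ∃ R : ℝ, 0 ≤ R ∧ Ω = {x | R < ‖x‖}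

/-- The function `r^(1/3) x̃¹ (x̃²)³`, where `x̃ = x / r` and `r = |x|`. -/
def graphFunction (x : E3) : ℝ :=
  ‖x‖ ^ (1 / 3 : ℝ) * (x 0 / ‖x‖) * (x 1 / ‖x‖) ^ 3

end

/-! Near infinity F equals f, which is even and homogeneous of degree 1/3; everything follows from
these two facts. Each derivative costs a power of r, so g - δ = -dF ⊗ dF is O(r^(-4/3)) and k is
O(r^(-5/3)). Hence R_g, |k|² and (tr k)² are each O(r^(-10/3)), which settles μ. For J a
cancellation is needed, since ∂k is only O(r^(-8/3)): k differs from the Hessian of F by O(r^(-3)),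
third derivatives of F commute, and all corrections are O(r^(-4)) (`isSymbol_currentDensity`). The
bookkeeping is done by `IsSymbol`, a class of functions stable under sums, products and
differentiation.

The energy integrand is O(r^(-7/3)) and loses to the area growth r². For linear momentum and center
of mass decay is not enough, but parity is: F even makes g and k even, so the integrands are odd and
integrate to zero on every large sphere.

The angular momentum integrand is a priori of size r^(-2/3). A rotation field Y is orthogonal to x,
and the Euler relations x·∇f = f/3 and Hess f · x = -(2/3)∇f turn π(Y, x/r) into the exact
expression r⁻¹(-(2/3)γ + (1/3) f tr_g k) Yf with γ = (1 - |∇f|²)^(-1/2)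
(`sum_momentum_mul_rotation`). Insert γ = 1 + |∇f|²/2 + O(r^(-8/3)) and tr_g k = Δf + O(r^(-3)). The
top term -(2/3) r⁻¹ Yf has zero integral over every sphere, because Y generates rotations. The next
one, (1/3) r⁻¹ Yf (f Δf - |∇f|²), is homogeneous of degree -2, so its sphere integral is independent
of r. The rest is O(r^(-10/3)) and disappears. The limit is thus the integral of a polynomial over
the unit sphere, evaluated through Gaussian moments.

A spacelike graph over all of ℝ³ comes from cutting f off near the origin and rescaling in a way
that preserves f. -/

open Asymptotics Bornology

/-! ### Integrals over the unit sphere -/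

/-- Integration in polar coordinates of a function which is a product of an angular and a radial
factor. -/
theorem integral_eq_sphere_mul_radial (φ : Metric.sphere (0 : E3) 1 → ℝ) (ψ : ℝ → ℝ) (f : E3 → ℝ)
    (hf : ∀ (v : Metric.sphere (0 : E3) 1) (r : ℝ), 0 < r → f (r • (v : E3)) = φ v * ψ r) :
    ∫ x, f x = (∫ v, φ v ∂(volume : Measure E3).toSphere) * ∫ r in Ioi (0 : ℝ), r ^ 2 * ψ r := by
  calc
    ∫ x, f x = ∫ x : ({(0 : E3)}ᶜ : Set E3), f x ∂((volume : Measure E3).comap Subtype.val) := by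
      rw [integral_subtype_comap (measurableSet_singleton _).compl f, restrict_compl_singleton]
    _ = ∫ x : Metric.sphere (0 : E3) 1 × Ioi (0 : ℝ), φ x.1 * ψ x.2
          ∂(volume : Measure E3).toSphere.prod
            (.volumeIoiPow (Module.finrank ℝ E3 - 1)) := by
      rw [← (volume : Measure E3).measurePreserving_homeomorphUnitSphereProd.integral_comp
        (Homeomorph.measurableEmbedding _)]
      refine integral_congr_ae (.of_forall fun x => ?_)
      have h := hf (homeomorphUnitSphereProd E3 x).1 (homeomorphUnitSphereProd E3 x).2
        (homeomorphUnitSphereProd E3 x).2.2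
      have hx : (((homeomorphUnitSphereProd E3 x).2 : ℝ) •
          ((homeomorphUnitSphereProd E3 x).1 : E3)) = x := by
        rw [← homeomorphUnitSphereProd_symm_apply_coe, Homeomorph.symm_apply_apply]
      rw [hx] at h
      exact h
    _ = (∫ v, φ v ∂(volume : Measure E3).toSphere) *
          ∫ r : Ioi (0 : ℝ), ψ r ∂(.volumeIoiPow (Module.finrank ℝ E3 - 1)) :=
      integral_prod_mul (L := ℝ) φ (fun r : Ioi (0 : ℝ) => ψ r)
    _ = _ := by
      simp only [Measure.volumeIoiPow, ENNReal.ofReal]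
      rw [integral_withDensity_eq_integral_smul,
        integral_subtype_comap measurableSet_Ioi
          fun a => Real.toNNReal (a ^ (Module.finrank ℝ E3 - 1)) • ψ a,
        setIntegral_congr_fun measurableSet_Ioi fun x hx => ?_]
      · simp only [NNReal.smul_def, Real.coe_toNNReal _ (pow_nonneg (le_of_lt (mem_Ioi.1 hx)) _)]
        simp
      · exact (measurable_subtype_coe.pow_const _).real_toNNReal

theorem integral_Ioi_pow_mul_exp_neg_sq (n : ℕ) :
    ∫ r in Ioi (0 : ℝ), r ^ n * Real.exp (-r ^ 2) = 1 / 2 * Real.Gamma ((n + 1) / 2) := by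
  have h := integral_rpow_mul_exp_neg_rpow (p := 2) (q := n) two_pos
    (by linarith [n.cast_nonneg (α := ℝ)])
  rw [← h]
  refine setIntegral_congr_fun measurableSet_Ioi fun x _ => ?_
  simp only [Real.rpow_natCast, Real.rpow_ofNat]

/-- An odd function has vanishing integral over the unit sphere. -/
theorem integral_sphere_eq_zero_of_odd (φ : E3 → ℝ) (hφ : ∀ v, ‖v‖ = 1 → φ (-v) = -φ v) :
    ∫ v : Metric.sphere (0 : E3) 1, φ v ∂(volume : Measure E3).toSphere = 0 := by
  have h := integral_eq_sphere_mul_radial (fun v => φ v) (fun r => Real.exp (-r ^ 2))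
    (fun x => φ (‖x‖⁻¹ • x) * Real.exp (-‖x‖ ^ 2)) (fun v r hr => by
      have hv : ‖(v : E3)‖ = 1 := by simp
      have : ‖r • (v : E3)‖ = r := by rw [norm_smul, hv, Real.norm_of_nonneg hr.le, mul_one]
      simp only [this, smul_smul, inv_mul_cancel₀ hr.ne', one_smul])
  -- The antipodal symmetry is taken from Lebesgue measure: the Gaussian extension of φ is odd off
  -- the origin. The radial factor is a positive Gamma value and can then be cancelled.
  have h0 : ∫ x : E3, φ (‖x‖⁻¹ • x) * Real.exp (-‖x‖ ^ 2) = 0 := by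
    have h1 := integral_neg_eq_self
      (fun x : E3 => φ (‖x‖⁻¹ • x) * Real.exp (-‖x‖ ^ 2)) volume
    have h2 : ∫ x : E3, φ (‖-x‖⁻¹ • -x) * Real.exp (-‖-x‖ ^ 2) =
        ∫ x : E3, -(φ (‖x‖⁻¹ • x) * Real.exp (-‖x‖ ^ 2)) := by
      refine integral_congr_ae ?_
      have : ∀ᵐ x : E3, x ≠ 0 := by simp [ae_iff, measure_singleton]
      filter_upwards [this] with x hx
      rw [norm_neg, smul_neg, hφ, neg_mul]
      rw [norm_smul, norm_inv, norm_norm, inv_mul_cancel₀ (norm_ne_zero_iff.2 hx)]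
    rw [integral_neg] at h2
    linarith
  rw [h0, integral_Ioi_pow_mul_exp_neg_sq] at h
  have hG : 1 / 2 * Real.Gamma (((2 : ℕ) + 1) / 2) ≠ 0 :=
    (mul_pos one_half_pos (Real.Gamma_pos_of_pos (by positivity))).ne'
  exact (mul_eq_zero.1 h.symm).resolve_right hG

/-- Polar coordinates for a Gaussian moment, as a relation between the integral of a
monomial over the unit sphere and the one-dimensional Gaussian moments. -/
theorem integral_sphere_monomial_mul (a b c : ℕ) :
    (∫ v : Metric.sphere (0 : E3) 1, (v : E3) 0 ^ a * (v : E3) 1 ^ b * (v : E3) 2 ^ c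
      ∂(volume : Measure E3).toSphere) * (1 / 2 * Real.Gamma ((a + b + c + 3) / 2)) =
    (∫ t : ℝ, t ^ a * Real.exp (-t ^ 2)) * (∫ t : ℝ, t ^ b * Real.exp (-t ^ 2)) *
      ∫ t : ℝ, t ^ c * Real.exp (-t ^ 2) := by
  have h := integral_eq_sphere_mul_radial
    (fun v => (v : E3) 0 ^ a * (v : E3) 1 ^ b * (v : E3) 2 ^ c)
    (fun r => r ^ (a + b + c) * Real.exp (-r ^ 2))
    (fun x => x 0 ^ a * x 1 ^ b * x 2 ^ c * Real.exp (-‖x‖ ^ 2)) (fun v r hr => by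
      have hv : ‖(v : E3)‖ = 1 := by simp
      have : ‖r • (v : E3)‖ = r := by rw [norm_smul, hv, Real.norm_of_nonneg hr.le, mul_one]
      simp only [this, PiLp.smul_apply, smul_eq_mul]
      ring)
  have hr : ∫ r in Ioi (0 : ℝ), r ^ 2 * (r ^ (a + b + c) * Real.exp (-r ^ 2)) =
      1 / 2 * Real.Gamma ((a + b + c + 3) / 2) := by
    have := integral_Ioi_pow_mul_exp_neg_sq (2 + (a + b + c))
    simp only [pow_add _ 2, mul_assoc] at this ⊢
    rw [this]
    push_cast
    ring_nf
  rw [hr] at h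
  rw [← h, ← (PiLp.volume_preserving_toLp (Fin 3)).integral_comp
    (MeasurableEquiv.toLp 2 (Fin 3 → ℝ)).measurableEmbedding]
  have hp := integral_fintype_prod_volume_eq_prod (𝕜 := ℝ) (ι := Fin 3) (E := fun _ => ℝ)
    (fun i t => t ^ (![a, b, c] i) * Real.exp (-t ^ 2))
  simp only [Fin.prod_univ_three, Matrix.cons_val] at hp
  rw [← hp]
  refine integral_congr_ae (.of_forall fun y => ?_)
  simp only [EuclideanSpace.norm_sq_eq, Fin.sum_univ_three, Real.norm_eq_abs, sq_abs, neg_add,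
    Real.exp_add]
  ring

theorem integral_pow_mul_exp_neg_sq_of_odd {n : ℕ} (hn : Odd n) :
    ∫ t : ℝ, t ^ n * Real.exp (-t ^ 2) = 0 := by
  have h1 := integral_neg_eq_self (fun t : ℝ => t ^ n * Real.exp (-t ^ 2)) volume
  simp only [hn.neg_pow, neg_sq, neg_mul, integral_neg] at h1
  linarith

theorem integral_pow_mul_exp_neg_sq_of_even {n : ℕ} (hn : Even n) :
    ∫ t : ℝ, t ^ n * Real.exp (-t ^ 2) = Real.Gamma ((n + 1) / 2) := by
  have h := integral_comp_abs (f := fun t : ℝ => t ^ n * Real.exp (-t ^ 2))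
  simp only [hn.pow_abs, sq_abs] at h
  rw [h, integral_Ioi_pow_mul_exp_neg_sq]
  ring

theorem integral_sphere_monomial_of_odd {a b c : ℕ} (h : Odd a ∨ Odd b ∨ Odd c) :
    ∫ v : Metric.sphere (0 : E3) 1, (v : E3) 0 ^ a * (v : E3) 1 ^ b * (v : E3) 2 ^ c
      ∂(volume : Measure E3).toSphere = 0 := by
  have h1 := integral_sphere_monomial_mul a b c
  have h2 : (∫ t : ℝ, t ^ a * Real.exp (-t ^ 2)) * (∫ t : ℝ, t ^ b * Real.exp (-t ^ 2)) *
      (∫ t : ℝ, t ^ c * Real.exp (-t ^ 2)) = 0 := by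
    rcases h with h | h | h <;> simp [integral_pow_mul_exp_neg_sq_of_odd h]
  have hG : Real.Gamma ((a + b + c + 3) / 2) ≠ 0 := (Real.Gamma_pos_of_pos (by positivity)).ne'
  rw [h2] at h1
  simpa [hG] using h1

/-- Half-integer Gamma values are double factorials times √π. At exponent zero the truncated `2 * 0
- 1 = 0` gives 0‼ = 1, which agrees with the convention (-1)‼ = 1. -/
theorem integral_sphere_monomial_of_even (a b c : ℕ) :
    ∫ v : Metric.sphere (0 : E3) 1, (v : E3) 0 ^ (2 * a) * (v : E3) 1 ^ (2 * b) *
        (v : E3) 2 ^ (2 * c) ∂(volume : Measure E3).toSphere =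
      4 * Real.pi * (Nat.doubleFactorial (2 * a - 1) * Nat.doubleFactorial (2 * b - 1) *
        Nat.doubleFactorial (2 * c - 1)) / Nat.doubleFactorial (2 * (a + b + c) + 1) := by
  have h1 := integral_sphere_monomial_mul (2 * a) (2 * b) (2 * c)
  simp only [integral_pow_mul_exp_neg_sq_of_even (even_two_mul _)] at h1
  have hk : ∀ k : ℕ, (((2 * k : ℕ) : ℝ) + 1) / 2 = k + 1 / 2 := fun k => by push_cast; ring
  have hs : (((2 * a : ℕ) : ℝ) + (2 * b : ℕ) + (2 * c : ℕ) + 3) / 2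
      = ((a + b + c : ℕ) : ℝ) + 1 + 1 / 2 := by push_cast; ring
  rw [hk, hk, hk, hs, Real.Gamma_nat_add_half, Real.Gamma_nat_add_half, Real.Gamma_nat_add_half,
    Real.Gamma_nat_add_one_add_half] at h1
  have hd : (Nat.doubleFactorial (2 * (a + b + c) + 1) : ℝ) ≠ 0 := by
    exact_mod_cast (Nat.doubleFactorial_pos _).ne'
  have hπ : Real.sqrt Real.pi ^ 2 = Real.pi := Real.sq_sqrt Real.pi_pos.le
  have hπ₀ : Real.sqrt Real.pi ≠ 0 := (Real.sqrt_pos.2 Real.pi_pos).ne'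
  rw [eq_div_iff hd]
  rw [pow_add _ (a + b + c), pow_add, pow_add] at h1
  field_simp at h1
  rw [← hπ]
  linear_combination h1

/-! ### Functions with controlled growth at infinity -/

/-- Complements of closed balls are open. This is what allows identities valid near infinity to be
differentiated. -/
theorem eventually_nhds_of_cobounded {p : E3 → Prop} (h : ∀ᶠ x in cobounded E3, p x) :
    ∀ᶠ x in cobounded E3, ∀ᶠ y in 𝓝 x, p y := by
  obtain ⟨r, -, hr⟩ := (Metric.hasBasis_cobounded_compl_closedBall (0 : E3)).eventually_iff.1 h
  exact (Metric.hasBasis_cobounded_compl_closedBall (0 : E3)).eventually_iff.2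
    ⟨r, trivial, fun x hx => (Metric.isClosed_closedBall.isOpen_compl.eventually_mem hx).mono
      fun y hy => hr hy⟩

theorem eventually_lt_norm (r : ℝ) : ∀ᶠ x in cobounded E3, r < ‖x‖ :=
  (Metric.hasBasis_cobounded_compl_closedBall (0 : E3)).eventually_iff.2
    ⟨r, trivial, fun x hx => by simpa using hx⟩

theorem eventually_ne_zero : ∀ᶠ x in cobounded E3, x ≠ 0 :=
  (eventually_lt_norm 0).mono fun _ hx => norm_pos_iff.1 hx

theorem exists_forall_lt_norm {p : E3 → Prop} (h : ∀ᶠ x in cobounded E3, p x) :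
    ∃ R : ℝ, 0 < R ∧ ∀ x, R < ‖x‖ → p x := by
  obtain ⟨r, -, hr⟩ := (Metric.hasBasis_cobounded_compl_closedBall (0 : E3)).eventually_iff.1 h
  exact ⟨max r 1, by positivity, fun x hx => hr (by simpa using (le_max_left _ _).trans_lt hx)⟩

theorem Filter.EventuallyEq.pd {u v : E3 → ℝ} (h : u =ᶠ[cobounded E3] v) (i : Fin 3) :
    pd i u =ᶠ[cobounded E3] pd i v := by
  filter_upwards [eventually_nhds_of_cobounded h] with x hx
  unfold _root_.pd
  rw [Filter.EventuallyEq.fderiv_eq hx]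

theorem isBigO_rpow_of_le {a b : ℝ} (h : a ≤ b) :
    (fun x : E3 => ‖x‖ ^ a) =O[cobounded E3] fun x => ‖x‖ ^ b := by
  refine IsBigO.of_bound 1 ?_
  filter_upwards [eventually_lt_norm 1] with x hx
  rw [one_mul, Real.norm_of_nonneg (by positivity), Real.norm_of_nonneg (by positivity)]
  exact Real.rpow_le_rpow_of_exponent_le hx.le h

theorem Asymptotics.IsBigO.mul_rpow {u v : E3 → ℝ} {a b c : ℝ}
    (hu : u =O[cobounded E3] fun x => ‖x‖ ^ a) (hv : v =O[cobounded E3] fun x => ‖x‖ ^ b)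
    (h : a + b ≤ c) : (fun x => u x * v x) =O[cobounded E3] fun x => ‖x‖ ^ c := by
  refine (hu.mul hv).trans (IsBigO.trans (IsBigO.of_bound 1 ?_) (isBigO_rpow_of_le h))
  filter_upwards [eventually_lt_norm 0] with x hx
  rw [← Real.rpow_add hx, one_mul]

/-- `u` is differentiable `n` times near infinity, with the partial derivatives of order `m ≤ n`
being `O(r ^ (a - m))`. -/
def IsSymbol : ℕ → ℝ → (E3 → ℝ) → Prop
  | 0, a, u => u =O[cobounded E3] fun x => ‖x‖ ^ a
  | n + 1, a, u => (u =O[cobounded E3] fun x => ‖x‖ ^ a) ∧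
      (∀ᶠ x in cobounded E3, DifferentiableAt ℝ u x) ∧ ∀ i, IsSymbol n (a - 1) (pd i u)

namespace IsSymbol

variable {n : ℕ} {a b c : ℝ} {u v : E3 → ℝ}

theorem isBigO (h : IsSymbol n a u) : u =O[cobounded E3] fun x => ‖x‖ ^ a := by
  cases n with
  | zero => exact h
  | succ n => exact h.1

theorem differentiableAt (h : IsSymbol (n + 1) a u) :
    ∀ᶠ x in cobounded E3, DifferentiableAt ℝ u x := h.2.1

theorem partialDeriv (h : IsSymbol (n + 1) a u) (i : Fin 3) : IsSymbol n (a - 1) (pd i u) := h.2.2 i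

theorem congr (h : IsSymbol n a u) (huv : u =ᶠ[cobounded E3] v) : IsSymbol n a v := by
  induction n generalizing a u v with
  | zero => exact (isBigO_congr huv .rfl).1 h
  | succ n ih =>
    refine ⟨(isBigO_congr huv .rfl).1 h.1, ?_, fun i => ih (h.2.2 i) (huv.pd i)⟩
    filter_upwards [eventually_nhds_of_cobounded huv, h.2.1] with x hx hd
    exact hd.congr_of_eventuallyEq (Filter.EventuallyEq.symm hx)

theorem of_le (h : IsSymbol n a u) (hab : a ≤ b) : IsSymbol n b u := by
  induction n generalizing a b u with
  | zero => exact IsBigO.trans h (isBigO_rpow_of_le hab)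
  | succ n ih =>
    exact ⟨h.1.trans (isBigO_rpow_of_le hab), h.2.1, fun i => ih (h.2.2 i) (by linarith)⟩

theorem of_succ (h : IsSymbol (n + 1) a u) : IsSymbol n a u := by
  induction n generalizing a u with
  | zero => exact h.1
  | succ n ih => exact ⟨h.1, h.2.1, fun i => ih (h.2.2 i)⟩

theorem add (hu : IsSymbol n a u) (hv : IsSymbol n a v) : IsSymbol n a (fun x => u x + v x) := by
  induction n generalizing a u v with
  | zero => exact IsBigO.add hu hv
  | succ n ih =>
    refine ⟨hu.1.add hv.1, (hu.2.1.and hv.2.1).mono fun x hx => hx.1.fun_add hx.2, fun i => ?_⟩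
    refine (ih (hu.2.2 i) (hv.2.2 i)).congr ?_
    filter_upwards [hu.2.1, hv.2.1] with x h1 h2
    simp [pd, fderiv_fun_add h1 h2]

theorem zero : IsSymbol n a (fun _ => 0) := by
  induction n generalizing a with
  | zero => exact isBigO_zero _ _
  | succ n ih =>
    refine ⟨isBigO_zero _ _, .of_forall fun x => differentiableAt_const _, fun i => ?_⟩
    exact ih.congr (.of_forall fun x => by simp [pd])

theorem sum {ι : Type*} (s : Finset ι) {w : ι → E3 → ℝ} (h : ∀ i ∈ s, IsSymbol n a (w i)) :
    IsSymbol n a (fun x => ∑ i ∈ s, w i x) := by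
  classical
  induction s using Finset.induction_on with
  | empty => simpa using zero
  | insert i s hi ih =>
    simp only [Finset.sum_insert hi]
    exact (h i (Finset.mem_insert_self _ _)).add
      (ih fun j hj => h j (Finset.mem_insert_of_mem hj))

/-- Leibniz rule and induction. The order is an inequality so that exponents can be relaxed at each
use. -/
theorem mul (hu : IsSymbol n a u) (hv : IsSymbol n b v) (hc : a + b ≤ c) :
    IsSymbol n c (fun x => u x * v x) := by
  induction n generalizing a b c u v with
  | zero => exact IsBigO.mul_rpow hu hv hc
  | succ n ih =>
    refine ⟨hu.1.mul_rpow hv.1 hc, (hu.2.1.and hv.2.1).mono fun x hx => hx.1.fun_mul hx.2,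
      fun i => ?_⟩
    refine ((ih hu.of_succ (hv.2.2 i) (by linarith)).add
      (ih (hu.2.2 i) hv.of_succ (c := c - 1) (by linarith))).congr ?_
    filter_upwards [hu.2.1, hv.2.1] with x h1 h2
    simp [pd, fderiv_fun_mul h1 h2]
    ring

theorem const (r : ℝ) : IsSymbol n 0 (fun _ => r) := by
  have h : (fun _ : E3 => r) =O[cobounded E3] fun x => ‖x‖ ^ (0 : ℝ) := by
    simpa using isBigO_const_const r (one_ne_zero (α := ℝ)) _
  cases n with
  | zero => exact h
  | succ n =>
    refine ⟨h, .of_forall fun x => differentiableAt_const _, fun i => ?_⟩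
    exact zero.congr (.of_forall fun x => by simp [pd])

theorem const_mul (r : ℝ) (hu : IsSymbol n a u) : IsSymbol n a (fun x => r * u x) :=
  (const r).mul hu (by simp)

theorem neg (hu : IsSymbol n a u) : IsSymbol n a (fun x => -u x) := by
  simpa using hu.const_mul (-1)

theorem sub (hu : IsSymbol n a u) (hv : IsSymbol n a v) : IsSymbol n a (fun x => u x - v x) := by
  simpa [sub_eq_add_neg] using hu.add hv.neg

theorem coord (i : Fin 3) : IsSymbol n 1 (fun x => x i) := by
  have h : (fun x : E3 => x i) =O[cobounded E3] fun x => ‖x‖ ^ (1 : ℝ) := by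
    refine IsBigO.of_bound 1 (.of_forall fun x => ?_)
    simpa using PiLp.norm_apply_le x i
  cases n with
  | zero => exact h
  | succ n =>
    refine ⟨h, .of_forall fun x => by fun_prop, fun j => ?_⟩
    rw [sub_self]
    refine (const (if i = j then 1 else 0)).congr (.of_forall fun x => ?_)
    have : HasFDerivAt (fun x : E3 => x i) (EuclideanSpace.proj i : E3 →L[ℝ] ℝ) x :=
      (EuclideanSpace.proj i : E3 →L[ℝ] ℝ).hasFDerivAt
    simp [pd, this.fderiv, PiLp.single_apply]

end IsSymbol

theorem hasFDerivAt_norm_rpow_of_ne_zero (a : ℝ) {x : E3} (hx : x ≠ 0) :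
    HasFDerivAt (fun x : E3 => ‖x‖ ^ a) ((a * ‖x‖ ^ (a - 2)) • innerSL ℝ x) x := by
  have hx0 : 0 < ‖x‖ := norm_pos_iff.2 hx
  have h1 := (hasStrictFDerivAt_norm_sq x).hasFDerivAt
  have h2 := h1.rpow_const (p := a / 2) (Or.inl (by positivity))
  have h3 : (fun x : E3 => (‖x‖ ^ 2) ^ (a / 2)) = fun x => ‖x‖ ^ a := by
    funext y
    rw [← Real.rpow_natCast, ← Real.rpow_mul (norm_nonneg y)]
    congr 1
    push_cast
    ring
  rw [h3] at h2
  refine h2.congr_fderiv ?_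
  rw [← Real.rpow_natCast, ← Real.rpow_mul hx0.le, ← Nat.cast_smul_eq_nsmul ℝ, smul_smul]
  congr 1
  push_cast
  rw [show 2 * (a / 2 - 1) = a - 2 by ring]
  ring

theorem pd_norm_rpow (a : ℝ) (i : Fin 3) {x : E3} (hx : x ≠ 0) :
    pd i (fun x : E3 => ‖x‖ ^ a) x = a * (x i * ‖x‖ ^ (a - 2)) := by
  rw [pd, (hasFDerivAt_norm_rpow_of_ne_zero a hx).fderiv]
  simp [EuclideanSpace.inner_single_right]
  ring

theorem IsSymbol.norm_rpow (n : ℕ) (a : ℝ) : IsSymbol n a (fun x => ‖x‖ ^ a) := by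
  induction n generalizing a with
  | zero => exact isBigO_refl _ _
  | succ n ih =>
    refine ⟨isBigO_refl _ _, eventually_ne_zero.mono fun x hx =>
      (hasFDerivAt_norm_rpow_of_ne_zero a hx).differentiableAt, fun i => ?_⟩
    refine (((IsSymbol.coord i).mul (ih (a - 2)) (c := a - 1) (by linarith)).const_mul a).congr ?_
    filter_upwards [eventually_ne_zero] with x hx
    rw [pd_norm_rpow a i hx]

/-! ### Symbols and iterated derivatives -/

theorem fderiv_eq_sum_pd {u : E3 → ℝ} (x : E3) :
    fderiv ℝ u x = ∑ i, pd i u x • (EuclideanSpace.proj i : E3 →L[ℝ] ℝ) := by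
  ext v
  conv_lhs => rw [← (EuclideanSpace.basisFun (Fin 3) ℝ).sum_repr v]
  simp [pd, mul_comm]

theorem isBigO_fderiv {u : E3 → ℝ} {a : ℝ} (h : ∀ i, pd i u =O[cobounded E3] fun x => ‖x‖ ^ a) :
    fderiv ℝ u =O[cobounded E3] fun x => ‖x‖ ^ a := by
  have : fderiv ℝ u = fun x => ∑ i, pd i u x • (EuclideanSpace.proj i : E3 →L[ℝ] ℝ) :=
    funext fderiv_eq_sum_pd
  rw [this]
  refine IsBigO.fun_sum fun i _ => ?_
  refine IsBigO.trans (IsBigO.of_bound ‖(EuclideanSpace.proj i : E3 →L[ℝ] ℝ)‖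
    (.of_forall fun x => ?_)) (h i)
  rw [norm_smul, mul_comm]

theorem IsSymbol.isBigOWithDerivs_one {u : E3 → ℝ} {a : ℝ} (h : IsSymbol 1 a u) :
    IsBigOWithDerivs 1 u a := by
  intro m hm
  interval_cases m
  · simpa using h.isBigO.norm_left
  · simpa [norm_iteratedFDeriv_one] using
      (isBigO_fderiv fun i => (h.partialDeriv i).isBigO).norm_left

theorem IsSymbol.isBigOWithDerivs_two {u : E3 → ℝ} {a : ℝ} (h : IsSymbol 2 a u) :
    IsBigOWithDerivs 2 u a := by
  intro m hm
  rcases Nat.lt_or_ge m 2 with hm2 | hm2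
  · exact h.of_succ.isBigOWithDerivs_one m (by omega)
  obtain rfl : m = 2 := by omega
  simp only [← norm_iteratedFDeriv_fderiv (n := 1), norm_iteratedFDeriv_one]
  refine IsBigO.norm_left ?_
  -- Differentiating du = ∑ ∂ᵢu dxⁱ reduces the second derivative to first derivatives of the ∂ᵢu.
  have h1 : fderiv ℝ (fderiv ℝ u) =ᶠ[cobounded E3] fun x =>
      ∑ i, (fderiv ℝ (pd i u) x).smulRight (EuclideanSpace.proj i : E3 →L[ℝ] ℝ) := by
    have h2 : ∀ᶠ x in cobounded E3, ∀ i, DifferentiableAt ℝ (pd i u) x :=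
      eventually_all.2 fun i => (h.partialDeriv i).differentiableAt
    filter_upwards [h2] with x hx
    have : fderiv ℝ u = fun x => ∑ i, pd i u x • (EuclideanSpace.proj i : E3 →L[ℝ] ℝ) :=
      funext fderiv_eq_sum_pd
    rw [this]
    exact (HasFDerivAt.fun_sum fun i _ => (hx i).hasFDerivAt.smul_const _).fderiv
  refine (isBigO_congr h1 .rfl).2 ?_
  refine IsBigO.fun_sum (s := Finset.univ) (g := fun x : E3 => ‖x‖ ^ (a - (2 : ℕ)))
    (A := fun i x => (fderiv ℝ (pd i u) x).smulRight (EuclideanSpace.proj i : E3 →L[ℝ] ℝ))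
    fun i _ => ?_
  have h3 : fderiv ℝ (pd i u) =O[cobounded E3] fun x => ‖x‖ ^ (a - 1 - 1) :=
    isBigO_fderiv fun j => ((h.partialDeriv i).partialDeriv j).isBigO
  have h4 := h3.trans (isBigO_rpow_of_le (show a - 1 - 1 ≤ a - (2 : ℕ) by norm_num; linarith))
  refine IsBigO.trans (IsBigO.of_bound ‖(EuclideanSpace.proj i : E3 →L[ℝ] ℝ)‖
    (.of_forall fun x => ?_)) h4
  rw [ContinuousLinearMap.norm_smulRight_apply, mul_comm]

section

/-! ### Geometry of spacelike graphs -/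

noncomputable section

/-- The Lorentz factor `(1 - |∇F|²)^(-1/2)` of the graph `t = F`. -/
def lorentzFactor (F : E3 → ℝ) (x : E3) : ℝ := 1 / Real.sqrt (1 - ∑ i, pd i F x ^ 2)

end

variable {F : E3 → ℝ} {x : E3}

theorem gradient_apply (F : E3 → ℝ) (x : E3) (i : Fin 3) : gradient F x i = pd i F x := by
  have h := InnerProductSpace.toDual_symm_apply (𝕜 := ℝ) (x := EuclideanSpace.single i (1 : ℝ))
    (y := fderiv ℝ F x)
  rw [EuclideanSpace.inner_single_right] at h
  simpa [gradient, pd] using h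

theorem norm_gradient_sq (F : E3 → ℝ) (x : E3) : ‖gradient F x‖ ^ 2 = ∑ i, pd i F x ^ 2 := by
  simp [EuclideanSpace.norm_sq_eq, gradient_apply]

theorem pd_graphMap (hF : DifferentiableAt ℝ F x) (i : Fin 3) :
    pd i (graphMap F) x = (pd i F x, EuclideanSpace.single i 1) := by
  have := hF.hasFDerivAt.prodMk (hasFDerivAt_id x)
  have h2 : fderiv ℝ (graphMap F) x = _ := this.fderiv
  simp [pd, h2]

theorem inducedMetric_apply (hF : DifferentiableAt ℝ F x) (i j : Fin 3) :
    inducedMetric F x i j = (if i = j then 1 else 0) - pd i F x * pd j F x := by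
  simp only [inducedMetric, Matrix.of_apply, pd_graphMap hF, minkowski]
  simp [EuclideanSpace.inner_single_left, PiLp.single_apply]
  ring

theorem differentiableAt_pd (hF : ContDiffAt ℝ 2 F x) (i : Fin 3) :
    DifferentiableAt ℝ (pd i F) x :=
  ((hF.fderiv_right (m := 1) (by norm_num)).differentiableAt one_ne_zero).clm_apply
    (differentiableAt_const _)

theorem pd_pd_eq (hF : ContDiffAt ℝ 2 F x) (i j : Fin 3) : pd i (pd j F) x =
    fderiv ℝ (fderiv ℝ F) x (EuclideanSpace.single i 1) (EuclideanSpace.single j 1) := by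
  have h : DifferentiableAt ℝ (fderiv ℝ F) x :=
    (hF.fderiv_right (m := 1) (by norm_num)).differentiableAt one_ne_zero
  have := (h.hasFDerivAt.clm_apply
    (hasFDerivAt_const (EuclideanSpace.single j (1 : ℝ) : E3) x)).fderiv
  have h2 : fderiv ℝ (pd j F) x = _ := this
  rw [pd, h2]
  simp

theorem pd_comm (hF : ContDiffAt ℝ 2 F x) (i j : Fin 3) : pd i (pd j F) x = pd j (pd i F) x := by
  rw [pd_pd_eq hF, pd_pd_eq hF]
  exact hF.isSymmSndFDerivAt (by simp) _ _

theorem secondFundamentalForm_apply (hF : ContDiffAt ℝ 2 F x) (i j : Fin 3) :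
    secondFundamentalForm F x i j = lorentzFactor F x * pd i (pd j F) x := by
  have h1 : pd i (pd j (graphMap F)) x = (pd i (pd j F) x, 0) := by
    have h2 : pd j (graphMap F) =ᶠ[𝓝 x] fun y => (pd j F y, EuclideanSpace.single j 1) := by
      filter_upwards [hF.eventually (by simp)] with y hy
      exact pd_graphMap (hy.differentiableAt (by simp)) j
    have h3 := ((differentiableAt_pd hF j).hasFDerivAt.prodMk
      (hasFDerivAt_const (EuclideanSpace.single j (1 : ℝ) : E3) x)).fderiv
    rw [pd, h2.fderiv_eq, h3]
    simp [pd]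
  simp only [secondFundamentalForm, Matrix.of_apply, h1, minkowski, unitNormal, norm_gradient_sq,
    lorentzFactor]
  simp

/-- The quadratic form is |v|² - (∇F·v)². Testing on v = ∇F gives one direction, Cauchy–Schwarz the
other. -/
theorem posDef_inducedMetric_iff (hF : DifferentiableAt ℝ F x) :
    (inducedMetric F x).PosDef ↔ ∑ i, pd i F x ^ 2 < 1 := by
  have hq : ∀ v : Fin 3 → ℝ, star v ⬝ᵥ (inducedMetric F x).mulVec v =
      ∑ i, v i ^ 2 - (∑ i, pd i F x * v i) ^ 2 := fun v => by
    simp [dotProduct, Matrix.mulVec, inducedMetric_apply hF, Fin.sum_univ_three]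
    ring
  constructor
  · intro h
    by_contra hlt
    have hne : (fun i => pd i F x) ≠ 0 := by
      rintro h0
      simp [fun i => congrFun h0 i] at hlt
    have h1 := h.dotProduct_mulVec_pos hne
    rw [hq] at h1
    simp only [← pow_two] at h1
    nlinarith
  · intro h
    refine Matrix.PosDef.of_dotProduct_mulVec_pos ?_ fun v hv => ?_
    · ext i j
      simp [inducedMetric_apply hF, mul_comm, eq_comm]
    · rw [hq]
      have hcs := Finset.sum_mul_sq_le_sq_mul_sq Finset.univ (fun i => pd i F x) v
      have hpos : 0 < ∑ i, v i ^ 2 := by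
        obtain ⟨i, hi⟩ := Function.ne_iff.1 hv
        exact Finset.sum_pos' (fun _ _ => sq_nonneg _)
          ⟨i, Finset.mem_univ _, by have : v i ≠ 0 := hi; positivity⟩
      nlinarith

theorem lorentzFactor_sq (h : ∑ i, pd i F x ^ 2 < 1) :
    lorentzFactor F x ^ 2 = 1 / (1 - ∑ i, pd i F x ^ 2) := by
  rw [lorentzFactor, div_pow, one_pow, Real.sq_sqrt (by linarith)]

/-- Sherman–Morrison formula for the rank-one perturbation δ - ∇F ⊗ ∇F. -/
theorem inducedMetric_inv_apply (hF : DifferentiableAt ℝ F x) (h : ∑ i, pd i F x ^ 2 < 1)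
    (i j : Fin 3) : (inducedMetric F x)⁻¹ i j =
      (if i = j then 1 else 0) + lorentzFactor F x ^ 2 * (pd i F x * pd j F x) := by
  have hne : 1 - ∑ i, pd i F x ^ 2 ≠ 0 := by linarith
  have : inducedMetric F x * Matrix.of (fun i j => (if i = j then 1 else 0) +
      lorentzFactor F x ^ 2 * (pd i F x * pd j F x)) = 1 := by
    have hl : lorentzFactor F x ^ 2 * (1 - ∑ i, pd i F x ^ 2) = 1 := by
      rw [lorentzFactor_sq h, one_div_mul_cancel hne]
    ext i j
    simp only [Matrix.mul_apply, inducedMetric_apply hF, Matrix.of_apply, Matrix.one_apply]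
    have : ∀ m, ((if i = m then (1 : ℝ) else 0) - pd i F x * pd m F x) *
        ((if m = j then 1 else 0) + lorentzFactor F x ^ 2 * (pd m F x * pd j F x)) =
        (if i = m then (if m = j then 1 else 0) else 0) +
        (if i = m then lorentzFactor F x ^ 2 * (pd m F x * pd j F x) else 0) -
        (if m = j then pd i F x * pd m F x else 0) -
        pd i F x * pd j F x * lorentzFactor F x ^ 2 * pd m F x ^ 2 := fun m => by
      split_ifs <;> ring
    simp only [this, Finset.sum_add_distrib, Finset.sum_sub_distrib, Finset.sum_ite_eq,
      Finset.sum_ite_eq', Finset.mem_univ, if_true, ← Finset.mul_sum]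
    linear_combination pd i F x * pd j F x * hl
  rw [Matrix.inv_eq_right_inv this, Matrix.of_apply]

theorem ContDiffOn.pd {Ω : Set E3} (hΩ : IsOpen Ω) (hF : ContDiffOn ℝ ∞ F Ω) (i : Fin 3) :
    ContDiffOn ℝ ∞ (pd i F) Ω :=
  (hF.fderiv_of_isOpen hΩ (by simp)).clm_apply contDiffOn_const

theorem ContDiffOn.lorentzFactor {Ω : Set E3} (hΩ : IsOpen Ω) (hF : ContDiffOn ℝ ∞ F Ω)
    (h : ∀ x ∈ Ω, ∑ i, _root_.pd i F x ^ 2 < 1) : ContDiffOn ℝ ∞ (lorentzFactor F) Ω := by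
  have h1 : ContDiffOn ℝ ∞ (fun x => 1 - ∑ i, _root_.pd i F x ^ 2) Ω :=
    contDiffOn_const.sub (ContDiffOn.sum fun i _ => (hF.pd hΩ i).pow 2)
  exact contDiffOn_const.div (h1.sqrt fun x hx => by linarith [h x hx])
    fun x hx => (Real.sqrt_pos.2 (by linarith [h x hx])).ne'

namespace IsSpacelikeGraph

variable {Ω : Set E3}

theorem contDiffAt (h : IsSpacelikeGraph Ω F) (hx : x ∈ Ω) : ContDiffAt ℝ ∞ F x :=
  h.smooth.contDiffAt (h.isOpen.mem_nhds hx)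

theorem differentiableAt (h : IsSpacelikeGraph Ω F) (hx : x ∈ Ω) : DifferentiableAt ℝ F x :=
  (h.contDiffAt hx).differentiableAt (by simp)

theorem sum_sq_lt_one (h : IsSpacelikeGraph Ω F) (hx : x ∈ Ω) : ∑ i, pd i F x ^ 2 < 1 :=
  (posDef_inducedMetric_iff (h.differentiableAt hx)).1 (h.spacelike x hx)

theorem of_sum_sq_lt_one (hΩ : IsOpen Ω) (hF : ContDiffOn ℝ ∞ F Ω)
    (h : ∀ x ∈ Ω, ∑ i, pd i F x ^ 2 < 1) : IsSpacelikeGraph Ω F where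
  isOpen := hΩ
  smooth := hF
  spacelike x hx := (posDef_inducedMetric_iff
    ((hF.contDiffAt (hΩ.mem_nhds hx)).differentiableAt (by simp))).2 (h x hx)

theorem isInitialDataSet (h : IsSpacelikeGraph Ω F) :
    IsInitialDataSet Ω (inducedMetric F) (secondFundamentalForm F) where
  isOpen := h.isOpen
  smooth_g i j := (contDiffOn_const.sub
    ((h.smooth.pd h.isOpen i).mul (h.smooth.pd h.isOpen j))).congr
    fun _ hx => inducedMetric_apply (h.differentiableAt hx) i j
  smooth_k i j := ((h.smooth.lorentzFactor h.isOpen fun _ hx => h.sum_sq_lt_one hx).mul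
    ((h.smooth.pd h.isOpen j).pd h.isOpen i)).congr fun _ hx =>
      secondFundamentalForm_apply (contDiffAt_infty.1 (h.contDiffAt hx) 2) i j
  posDef := h.spacelike
  symm x hx := by
    have h2 : ContDiffAt ℝ 2 F x := contDiffAt_infty.1 (h.contDiffAt hx) 2
    ext i j
    rw [Matrix.transpose_apply, secondFundamentalForm_apply h2, secondFundamentalForm_apply h2,
      pd_comm h2]

end IsSpacelikeGraph

/-! ### Exterior regions -/

theorem isConnected_lt_norm {R : ℝ} (hR : 0 ≤ R) : IsConnected {x : E3 | R < ‖x‖} := by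
  have h1 : IsConnected (Metric.sphere (0 : E3) 1) :=
    isConnected_sphere (by rw [← Module.finrank_eq_rank]; norm_num) 0 zero_le_one
  have h2 := (isConnected_Ioi (a := R)).prod h1
  have h3 := h2.image (fun p : ℝ × E3 => p.1 • p.2) (by fun_prop)
  convert h3 using 1
  ext x
  constructor
  · intro hx
    have hx' : R < ‖x‖ := hx
    have hx0 : ‖x‖ ≠ 0 := (hR.trans_lt hx').ne'
    refine ⟨(‖x‖, ‖x‖⁻¹ • x), ⟨hx', ?_⟩, ?_⟩
    · simp [norm_smul, hx0]
    · simp [smul_smul, hx0]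
  · rintro ⟨⟨r, v⟩, ⟨hr, hv⟩, rfl⟩
    have hr' : R < r := hr
    have hv' : ‖v‖ = 1 := by simpa using hv
    simpa [norm_smul, hv', abs_of_pos (hR.trans_lt hr')] using hr'

theorem compl_lt_norm (R : ℝ) : {x : E3 | R < ‖x‖}ᶜ = Metric.closedBall 0 R := by
  ext x
  simp

theorem IsExteriorRegion.exists_isCompact {Ω : Set E3} (h : IsExteriorRegion Ω) :
    ∃ K ⊆ Ω, IsCompact K ∧ IsCompact (Ω \ K)ᶜ ∧ IsConnected (Ω \ K) := by
  rcases h with rfl | ⟨R, hR, rfl⟩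
  -- Over all of ℝ³ the unit ball is removed to leave an end; an exterior region is already one, so
  -- K is empty there.
  · refine ⟨Metric.closedBall 0 1, subset_univ _, isCompact_closedBall _ _, ?_⟩
    rw [← compl_eq_univ_sdiff, compl_compl, ← compl_lt_norm, compl_compl]
    refine ⟨?_, isConnected_lt_norm zero_le_one⟩
    rw [compl_lt_norm]
    exact isCompact_closedBall _ _
  · refine ⟨∅, empty_subset _, isCompact_empty, ?_⟩
    rw [sdiff_empty, compl_lt_norm]
    exact ⟨isCompact_closedBall _ _, isConnected_lt_norm hR⟩

theorem IsExteriorRegion.eventually_mem {Ω : Set E3} (h : IsExteriorRegion Ω) :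
    ∀ᶠ x in cobounded E3, x ∈ Ω := by
  rcases h with rfl | ⟨R, hR, rfl⟩
  · exact .of_forall fun x => mem_univ x
  · exact eventually_lt_norm R

end

/-! ### Decay of the initial data of a graph of growth `r^(1/3)` -/

theorem one_div_sqrt_bounds {s : ℝ} (h0 : 0 ≤ s) (h1 : s ≤ 1 / 2) :
    0 ≤ 1 / Real.sqrt (1 - s) ∧ 1 / Real.sqrt (1 - s) ≤ 2 ∧ |1 / Real.sqrt (1 - s) - 1| ≤ s ∧
      |1 / Real.sqrt (1 - s) - 1 - 1 / 2 * s| ≤ s ^ 2 := by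
  set γ := 1 / Real.sqrt (1 - s) with hγ
  have hpos : 0 < Real.sqrt (1 - s) := Real.sqrt_pos.2 (by linarith)
  have hγ0 : 0 < γ := by positivity
  have hsq : γ ^ 2 * (1 - s) = 1 := by
    rw [hγ, div_pow, Real.sq_sqrt (by linarith), one_pow, one_div_mul_cancel (by linarith)]
  have hγ2 : γ ^ 2 ≤ 2 := by nlinarith [sq_nonneg γ]
  have hγ1 : 1 ≤ γ := by nlinarith [mul_nonneg h0 (sq_nonneg γ)]
  clear_value γ
  have ha : γ - 1 ≤ s := by nlinarith [mul_nonneg h0 (sq_nonneg γ)]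
  -- From γ² - 1 = γ² s. Since 2γ + 1 ≤ 2(1 + γ), the Taylor remainder is at most s(γ - 1) ≤ s².
  have he : (γ - 1 - 1 / 2 * s) * (2 * (1 + γ)) = s * (2 * γ + 1) * (γ - 1) := by
    linear_combination 2 * hsq
  have hb : γ - 1 - 1 / 2 * s ≤ s * (γ - 1) := by
    nlinarith [mul_nonneg h0 (sub_nonneg.2 hγ1)]
  have hc : 0 ≤ γ - 1 - 1 / 2 * s := by
    have h2 : 0 ≤ s * (2 * γ + 1) * (γ - 1) := by
      have := sub_nonneg.2 hγ1
      positivity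
    by_contra hlt
    nlinarith
  refine ⟨hγ0.le, by nlinarith, ?_, ?_⟩
  · rw [abs_of_nonneg (by linarith)]; exact ha
  · rw [abs_of_nonneg hc]; nlinarith

theorem pd_sub_const (u : E3 → ℝ) (c : ℝ) (i : Fin 3) : pd i (fun y => u y - c) = pd i u := by
  funext x
  simp [pd, fderiv_sub_const]

theorem hasFDerivAt_lorentzFactor {F : E3 → ℝ} {x : E3} (hx : ∑ i, pd i F x ^ 2 ≤ 1 / 2)
    (h : ∀ i, DifferentiableAt ℝ (pd i F) x) :
    HasFDerivAt (lorentzFactor F)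
      (lorentzFactor F x ^ 3 • ∑ m, pd m F x • fderiv ℝ (pd m F) x) x := by
  have hp : 0 < 1 - ∑ i, pd i F x ^ 2 := by linarith
  have h1 : HasFDerivAt (fun x => 1 - ∑ i, pd i F x ^ 2)
      (-∑ i, (2 * pd i F x) • fderiv ℝ (pd i F) x) x := by
    refine (HasFDerivAt.fun_sum fun i _ => ?_).const_sub 1
    simpa using (h i).hasFDerivAt.pow 2
  have h2 := ((Real.hasDerivAt_sqrt hp.ne').inv (Real.sqrt_pos.2 hp).ne').comp_hasFDerivAt x h1
  have h3 : lorentzFactor F = fun x => (Real.sqrt (1 - ∑ i, pd i F x ^ 2))⁻¹ := by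
    funext y
    rw [lorentzFactor, one_div]
  rw [h3]
  refine h2.congr_fderiv ?_
  ext v
  simp [Fin.sum_univ_three]
  field_simp
  ring

section Decay

variable {F : E3 → ℝ} (hs : ∀ n, IsSymbol n (1 / 3) F)
  (hd : ∀ᶠ x in cobounded E3, ContDiffAt ℝ ∞ F x)

include hs

theorem isSymbol_pd (n : ℕ) (i : Fin 3) : IsSymbol n (-(2 / 3)) (pd i F) :=
  ((hs (n + 1)).partialDeriv i).of_le (by norm_num)

theorem isSymbol_pd_pd (n : ℕ) (i j : Fin 3) : IsSymbol n (-(5 / 3)) (pd i (pd j F)) :=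
  ((isSymbol_pd hs (n + 1) j).partialDeriv i).of_le (by norm_num)

theorem isSymbol_sum_sq (n : ℕ) : IsSymbol n (-(4 / 3)) (fun x => ∑ i, pd i F x ^ 2) :=
  IsSymbol.sum _ fun i _ => by
    simpa only [pow_two] using (isSymbol_pd hs n i).mul (isSymbol_pd hs n i) (by norm_num)

/-- The threshold 1/2 gives both spacelikeness and the range in which `one_div_sqrt_bounds` applies.
-/
theorem eventually_sum_sq_le : ∀ᶠ x in cobounded E3, ∑ i, pd i F x ^ 2 ≤ 1 / 2 := by
  have h1 : Tendsto (fun x : E3 => ‖x‖ ^ (-(4 / 3) : ℝ)) (cobounded E3) (𝓝 0) :=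
    (tendsto_rpow_neg_atTop (by norm_num)).comp tendsto_norm_cobounded_atTop
  have h2 := (isSymbol_sum_sq hs 0).isBigO.trans_tendsto h1
  exact (h2.eventually (Iio_mem_nhds one_half_pos)).mono fun x hx => le_of_lt hx

theorem isBigO_lorentzFactor_sub_one :
    (fun x => lorentzFactor F x - 1) =O[cobounded E3] fun x => ‖x‖ ^ (-(4 / 3) : ℝ) := by
  refine IsBigO.trans (IsBigO.of_bound 1 ?_) (isSymbol_sum_sq hs 0).isBigO
  filter_upwards [eventually_sum_sq_le hs] with x hx
  have h0 : 0 ≤ ∑ i, pd i F x ^ 2 := Finset.sum_nonneg fun _ _ => sq_nonneg _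
  rw [one_mul, Real.norm_eq_abs, Real.norm_of_nonneg h0]
  exact (one_div_sqrt_bounds h0 hx).2.2.1

theorem isBigO_lorentzFactor_sub_taylor :
    (fun x => lorentzFactor F x - 1 - 1 / 2 * ∑ i, pd i F x ^ 2) =O[cobounded E3]
      fun x => ‖x‖ ^ (-(8 / 3) : ℝ) := by
  have h := (isSymbol_sum_sq hs 0).isBigO
  refine IsBigO.trans (IsBigO.of_bound 1 ?_) (h.mul_rpow h (c := -(8 / 3)) (by norm_num))
  filter_upwards [eventually_sum_sq_le hs] with x hx
  have h0 : 0 ≤ ∑ i, pd i F x ^ 2 := Finset.sum_nonneg fun _ _ => sq_nonneg _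
  rw [one_mul, Real.norm_eq_abs, Real.norm_of_nonneg (mul_nonneg h0 h0), ← pow_two]
  exact (one_div_sqrt_bounds h0 hx).2.2.2

theorem pd_lorentzFactor_eventuallyEq (i : Fin 3) :
    pd i (lorentzFactor F) =ᶠ[cobounded E3]
      fun x => lorentzFactor F x * lorentzFactor F x * lorentzFactor F x *
        ∑ m, pd m F x * pd i (pd m F) x := by
  have h2 : ∀ᶠ x in cobounded E3, ∀ i, DifferentiableAt ℝ (pd i F) x :=
    eventually_all.2 fun i => (isSymbol_pd hs 1 i).differentiableAt
  filter_upwards [eventually_sum_sq_le hs, h2] with x hx h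
  rw [pd, (hasFDerivAt_lorentzFactor hx h).fderiv]
  simp [pd]
  ring_nf
  simp

/-- Bootstrap: ∂ᵢγ = γ³ ∑ ∂ₘF ∂ᵢ∂ₘF involves γ itself undifferentiated, so control of n derivatives
gives control of n + 1. -/
theorem isSymbol_lorentzFactor (n : ℕ) : IsSymbol n 0 (lorentzFactor F) := by
  have h0 : lorentzFactor F =O[cobounded E3] fun x => ‖x‖ ^ (0 : ℝ) := by
    simpa using ((isBigO_lorentzFactor_sub_one hs).trans
      (isBigO_rpow_of_le (b := 0) (by norm_num))).add (IsSymbol.const (n := 0) 1).isBigO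
  induction n with
  | zero => exact h0
  | succ n ih =>
    refine ⟨h0, ?_, fun i => ?_⟩
    · have h2 : ∀ᶠ x in cobounded E3, ∀ i, DifferentiableAt ℝ (pd i F) x :=
        eventually_all.2 fun i => (isSymbol_pd hs 1 i).differentiableAt
      filter_upwards [eventually_sum_sq_le hs, h2] with x hx h
      exact (hasFDerivAt_lorentzFactor hx h).differentiableAt
    · refine IsSymbol.congr ?_ (pd_lorentzFactor_eventuallyEq hs i).symm
      exact ((ih.mul ih (c := 0) (by simp)).mul ih (c := 0) (by simp)).mul
        (IsSymbol.sum _ fun m _ => (isSymbol_pd hs n m).mul (isSymbol_pd_pd hs n i m)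
          (c := -(7 / 3)) (by norm_num)) (by norm_num)

theorem isSymbol_lorentzFactor_sub_one (n : ℕ) :
    IsSymbol n (-(4 / 3)) (fun x => lorentzFactor F x - 1) := by
  cases n with
  | zero => exact isBigO_lorentzFactor_sub_one hs
  | succ n =>
    refine ⟨isBigO_lorentzFactor_sub_one hs,
      (isSymbol_lorentzFactor hs 1).differentiableAt.mono fun x hx => hx.sub_const 1, fun i => ?_⟩
    rw [pd_sub_const]
    have ih := isSymbol_lorentzFactor hs n
    refine IsSymbol.congr ?_ (pd_lorentzFactor_eventuallyEq hs i).symm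
    exact ((ih.mul ih (c := 0) (by simp)).mul ih (c := 0) (by simp)).mul
      (IsSymbol.sum _ fun m _ => (isSymbol_pd hs n m).mul (isSymbol_pd_pd hs n i m)
        (c := -(7 / 3)) (by norm_num)) (by norm_num)

theorem isSymbol_inducedMetric_sub (n : ℕ) (i j : Fin 3) :
    IsSymbol n (-(4 / 3)) (fun x => inducedMetric F x i j - if i = j then 1 else 0) := by
  refine ((isSymbol_pd hs n i).mul (isSymbol_pd hs n j) (c := -(4 / 3)) (by norm_num)).neg.congr ?_
  filter_upwards [(hs 1).differentiableAt] with x hx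
  rw [inducedMetric_apply hx]
  ring

theorem isSymbol_inducedMetric_inv_sub (n : ℕ) (i j : Fin 3) :
    IsSymbol n (-(4 / 3)) (fun x => (inducedMetric F x)⁻¹ i j - if i = j then 1 else 0) := by
  have hl := isSymbol_lorentzFactor hs n
  refine ((hl.mul hl (c := 0) (by simp)).mul ((isSymbol_pd hs n i).mul (isSymbol_pd hs n j)
    (c := -(4 / 3)) (by norm_num)) (c := -(4 / 3)) (by norm_num)).congr ?_
  filter_upwards [(hs 1).differentiableAt, eventually_sum_sq_le hs] with x hx h
  rw [inducedMetric_inv_apply hx (by linarith)]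
  ring

theorem isSymbol_inducedMetric_inv (n : ℕ) (i j : Fin 3) :
    IsSymbol n 0 (fun x => (inducedMetric F x)⁻¹ i j) := by
  simpa using ((isSymbol_inducedMetric_inv_sub hs n i j).of_le (b := 0) (by norm_num)).add
    (IsSymbol.const (if i = j then 1 else 0))

theorem isSymbol_pd_inducedMetric (n : ℕ) (k i j : Fin 3) :
    IsSymbol n (-(7 / 3)) (pd k fun x => inducedMetric F x i j) := by
  have := (isSymbol_inducedMetric_sub hs (n + 1) i j).partialDeriv k
  rw [pd_sub_const] at this
  exact this.of_le (by norm_num)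

theorem isSymbol_christoffel (n : ℕ) (l i j : Fin 3) :
    IsSymbol n (-(7 / 3)) (christoffel (inducedMetric F) l i j) :=
  (IsSymbol.sum _ fun m _ => (isSymbol_inducedMetric_inv hs n l m).mul
    (((isSymbol_pd_inducedMetric hs n i m j).add (isSymbol_pd_inducedMetric hs n j m i)).sub
      (isSymbol_pd_inducedMetric hs n m i j)) (by norm_num)).const_mul _

theorem isSymbol_ricciCurvature (n : ℕ) (i j : Fin 3) :
    IsSymbol n (-(10 / 3)) (ricciCurvature (inducedMetric F) i j) := by
  have hΓ := fun l i j => isSymbol_christoffel hs n l i j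
  have hdΓ : ∀ m l i j, IsSymbol n (-(10 / 3)) (pd m (christoffel (inducedMetric F) l i j)) :=
    fun m l i j => ((isSymbol_christoffel hs (n + 1) l i j).partialDeriv m).of_le (by norm_num)
  exact IsSymbol.sum _ fun l _ => ((hdΓ l l i j).sub (hdΓ j l i l)).add
    (IsSymbol.sum _ fun m _ => ((hΓ l l m).mul (hΓ m i j) (by norm_num)).sub
      ((hΓ l j m).mul (hΓ m i l) (by norm_num)))

theorem isSymbol_scalarCurvature (n : ℕ) :
    IsSymbol n (-(10 / 3)) (scalarCurvature (inducedMetric F)) :=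
  IsSymbol.sum _ fun i _ => IsSymbol.sum _ fun j _ =>
    (isSymbol_inducedMetric_inv hs n i j).mul (isSymbol_ricciCurvature hs n i j) (by norm_num)

include hd

/-- The factor γ - 1 gains r^(-4/3) over the Hessian. This gain is what makes the decay of J
possible. -/
theorem isSymbol_secondFundamentalForm_sub (n : ℕ) (i j : Fin 3) :
    IsSymbol n (-3) (fun x => secondFundamentalForm F x i j - pd i (pd j F) x) := by
  refine ((isSymbol_lorentzFactor_sub_one hs n).mul (isSymbol_pd_pd hs n i j)
    (by norm_num)).congr ?_
  filter_upwards [hd] with x hx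
  rw [secondFundamentalForm_apply (contDiffAt_infty.1 hx 2)]
  ring

theorem isSymbol_secondFundamentalForm (n : ℕ) (i j : Fin 3) :
    IsSymbol n (-(5 / 3)) (fun x => secondFundamentalForm F x i j) := by
  simpa using ((isSymbol_secondFundamentalForm_sub hs hd n i j).of_le (b := -(5 / 3))
    (by norm_num)).add (isSymbol_pd_pd hs n i j)

theorem isSymbol_metricTrace (n : ℕ) :
    IsSymbol n (-(5 / 3)) (metricTrace (inducedMetric F) (secondFundamentalForm F)) :=
  IsSymbol.sum _ fun i _ => IsSymbol.sum _ fun j _ =>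
    (isSymbol_inducedMetric_inv hs n i j).mul (isSymbol_secondFundamentalForm hs hd n i j)
      (by norm_num)

theorem isSymbol_metricNormSq (n : ℕ) :
    IsSymbol n (-(10 / 3)) (metricNormSq (inducedMetric F) (secondFundamentalForm F)) :=
  IsSymbol.sum _ fun i _ => IsSymbol.sum _ fun j _ => IsSymbol.sum _ fun a _ =>
    IsSymbol.sum _ fun b _ =>
      (((isSymbol_inducedMetric_inv hs n i a).mul (isSymbol_inducedMetric_inv hs n j b)
        (c := 0) (by norm_num)).mul (isSymbol_secondFundamentalForm hs hd n i j)
          (c := -(5 / 3)) (by norm_num)).mul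
        (isSymbol_secondFundamentalForm hs hd n a b) (by norm_num)

/-- The three terms decay fast enough separately, so no cancellation through the Gauss equation is
required. -/
theorem isSymbol_massDensity (n : ℕ) :
    IsSymbol n (-(10 / 3)) (massDensity (inducedMetric F) (secondFundamentalForm F)) := by
  have ht := isSymbol_metricTrace hs hd n
  have := (((isSymbol_scalarCurvature hs n).sub (isSymbol_metricNormSq hs hd n)).add
    (ht.mul ht (by norm_num))).const_mul (1 / 2)
  exact this.congr (.of_forall fun x => by rw [massDensity, pow_two])

theorem isSymbol_covDeriv_sub (n : ℕ) (l i j : Fin 3) :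
    IsSymbol n (-4) (fun x => covDeriv (inducedMetric F) (secondFundamentalForm F) l i j x -
      pd l (fun y => secondFundamentalForm F y i j) x) := by
  have := (IsSymbol.sum (n := n) (a := -4) Finset.univ fun m _ =>
    ((isSymbol_christoffel hs n m l i).mul (isSymbol_secondFundamentalForm hs hd n m j)
      (by norm_num)).add
    ((isSymbol_christoffel hs n m l j).mul (isSymbol_secondFundamentalForm hs hd n i m)
      (by norm_num))).neg
  simpa [covDeriv] using this

theorem isSymbol_covDeriv (n : ℕ) (l i j : Fin 3) :
    IsSymbol n (-(8 / 3)) (covDeriv (inducedMetric F) (secondFundamentalForm F) l i j) := by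
  have := ((isSymbol_covDeriv_sub hs hd n l i j).of_le (b := -(8 / 3)) (by norm_num)).add
    (((isSymbol_secondFundamentalForm hs hd (n + 1) i j).partialDeriv l).of_le (by norm_num))
  simpa using this

theorem isSymbol_flat_codazzi (n : ℕ) (l j : Fin 3) :
    IsSymbol n (-4) (fun x => pd l (fun y => secondFundamentalForm F y l j) x -
      pd j (fun y => secondFundamentalForm F y l l) x) := by
  have h1 := isSymbol_secondFundamentalForm_sub hs hd (n + 1)
  refine ((((h1 l j).partialDeriv l).of_le (b := -4) (by norm_num)).sub
    (((h1 l l).partialDeriv j).of_le (b := -4) (by norm_num))).congr ?_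
  have hk := fun i j => (isSymbol_secondFundamentalForm hs hd 1 i j).differentiableAt
  have hf := fun i j => (isSymbol_pd_pd hs 1 i j).differentiableAt
  filter_upwards [eventually_nhds_of_cobounded hd, hk l j, hk l l, hf l j, hf l l]
    with x hx h1 h2 h3 h4
  -- Third derivatives commute: the Hessian of F satisfies the flat Codazzi equation exactly.
  have hc : pd l (pd l (pd j F)) x = pd j (pd l (pd l F)) x := by
    have he : pd l (pd j F) =ᶠ[𝓝 x] pd j (pd l F) :=
      hx.mono fun y hy => pd_comm (contDiffAt_infty.1 hy 2) l j
    have h5 : pd l (pd l (pd j F)) x = pd l (pd j (pd l F)) x := by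
      rw [pd, he.fderiv_eq, pd]
    have h6 : ContDiffAt ℝ 2 (pd l F) x :=
      ((contDiffAt_infty.1 hx.self_of_nhds 3).fderiv_right (m := 2) (by norm_num)).clm_apply
        contDiffAt_const
    rw [h5, pd_comm h6]
  have hp : ∀ (i : Fin 3) {u v : E3 → ℝ}, DifferentiableAt ℝ u x → DifferentiableAt ℝ v x →
      pd i (fun y => u y - v y) x = pd i u x - pd i v x := fun i u v hu hv => by
    simp [pd, fderiv_fun_sub hu hv]
  rw [hp _ h1 h3, hp _ h2 h4, hc]
  ring

/-- J splits into four pieces of order r^(-4): (g⁻¹ - δ) against ∇k, the Christoffel terms of ∇k,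
the flat Codazzi difference, and minus the derivative of (g⁻¹ - δ) against k. -/
theorem isSymbol_currentDensity (j : Fin 3) :
    IsSymbol 0 (-4) (currentDensity (inducedMetric F) (secondFundamentalForm F) j) := by
  set g := inducedMetric F
  set k := secondFundamentalForm F
  have he := isSymbol_inducedMetric_inv_sub hs
  have hk := isSymbol_secondFundamentalForm hs hd
  have hek : ∀ l i, IsSymbol 1 (-3) fun x => ((g x)⁻¹ l i - if l = i then 1 else 0) * k x l i :=
    fun l i => (he 1 l i).mul (hk 1 l i) (by norm_num)
  have h1 : IsSymbol 0 (-4) fun x => ∑ l, ∑ i,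
      ((g x)⁻¹ l i - if l = i then 1 else 0) * covDeriv g k l i j x :=
    IsSymbol.sum _ fun l _ => IsSymbol.sum _ fun i _ =>
      (he 0 l i).mul (isSymbol_covDeriv hs hd 0 l i j) (by norm_num)
  have h2 : IsSymbol 0 (-4) fun x => ∑ l, (covDeriv g k l l j x - pd l (fun y => k y l j) x) :=
    IsSymbol.sum _ fun l _ => isSymbol_covDeriv_sub hs hd 0 l l j
  have h3 : IsSymbol 0 (-4) fun x =>
      ∑ l, (pd l (fun y => k y l j) x - pd j (fun y => k y l l) x) :=
    IsSymbol.sum _ fun l _ => isSymbol_flat_codazzi hs hd 0 l j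
  have h4 : IsSymbol 0 (-4) fun x => ∑ l, ∑ i,
      pd j (fun x => ((g x)⁻¹ l i - if l = i then 1 else 0) * k x l i) x :=
    IsSymbol.sum _ fun l _ => IsSymbol.sum _ fun i _ =>
      ((hek l i).partialDeriv j).of_le (by norm_num)
  refine (((h1.add h2).add h3).sub h4).congr ?_
  have hd1 : ∀ᶠ x in cobounded E3, ∀ l i, DifferentiableAt ℝ
      (fun x => ((g x)⁻¹ l i - if l = i then 1 else 0) * k x l i) x :=
    eventually_all.2 fun l => eventually_all.2 fun i => (hek l i).differentiableAt
  have hd2 : ∀ᶠ x in cobounded E3, ∀ l i, DifferentiableAt ℝ (fun x => k x l i) x :=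
    eventually_all.2 fun l => eventually_all.2 fun i => (hk 1 l i).differentiableAt
  filter_upwards [hd1, hd2] with x hx1 hx2
  have ht : pd j (metricTrace g k) x = (∑ l, ∑ i,
      pd j (fun x => ((g x)⁻¹ l i - if l = i then 1 else 0) * k x l i) x) +
      ∑ l, pd j (fun y => k y l l) x := by
    have hm : metricTrace g k = fun x => (∑ l, ∑ i,
        ((g x)⁻¹ l i - if l = i then 1 else 0) * k x l i) + ∑ l, k x l l := by
      funext y
      simp [metricTrace, sub_mul, Finset.sum_sub_distrib]
    have hD := ((HasFDerivAt.fun_sum fun l (_ : l ∈ Finset.univ) =>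
      HasFDerivAt.fun_sum fun i (_ : i ∈ Finset.univ) => (hx1 l i).hasFDerivAt).add
      (HasFDerivAt.fun_sum fun l (_ : l ∈ Finset.univ) => (hx2 l l).hasFDerivAt)).fderiv
    rw [pd, hm]
    erw [hD]
    simp [pd]
  rw [currentDensity, ht]
  simp only [sub_mul, Finset.sum_sub_distrib, ite_mul, one_mul, zero_mul, Finset.sum_ite_eq,
    Finset.mem_univ, if_true]
  ring

theorem isBigO_currentDensityNorm :
    currentDensityNorm (inducedMetric F) (secondFundamentalForm F) =O[cobounded E3]
      fun x => ‖x‖ ^ (-4 : ℝ) := by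
  have hJ := isSymbol_currentDensity hs hd
  have h : IsSymbol 0 (-8) fun x => ∑ i, ∑ j, (inducedMetric F x)⁻¹ i j *
      currentDensity (inducedMetric F) (secondFundamentalForm F) i x *
      currentDensity (inducedMetric F) (secondFundamentalForm F) j x :=
    IsSymbol.sum _ fun i _ => IsSymbol.sum _ fun j _ =>
      ((isSymbol_inducedMetric_inv hs 0 i j).mul (hJ i) (c := -4) (by norm_num)).mul (hJ j)
        (by norm_num)
  obtain ⟨C, hC⟩ := h.isBigO.bound
  refine IsBigO.of_bound (Real.sqrt C) ?_
  filter_upwards [hC, eventually_lt_norm 0] with x hx h0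
  have h8 : ‖x‖ ^ (-8 : ℝ) = (‖x‖ ^ (-4 : ℝ)) ^ 2 := by
    rw [← Real.rpow_natCast, ← Real.rpow_mul h0.le]
    norm_num
  rw [currentDensityNorm, Real.norm_of_nonneg (Real.sqrt_nonneg _),
    Real.norm_of_nonneg (by positivity)]
  rw [Real.norm_of_nonneg (by positivity : (0 : ℝ) ≤ ‖x‖ ^ (-8 : ℝ)), h8] at hx
  calc _ ≤ Real.sqrt (C * (‖x‖ ^ (-4 : ℝ)) ^ 2) := Real.sqrt_le_sqrt ((le_abs_self _).trans hx)
    _ = _ := by rw [Real.sqrt_mul' _ (by positivity), Real.sqrt_sq (by positivity)]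

end Decay

section

/-! ### Coordinate derivatives of products -/

theorem pd_coord (i j : Fin 3) (x : E3) : pd i (fun x => x j) x = if i = j then 1 else 0 := by
  have : HasFDerivAt (fun x : E3 => x j) (EuclideanSpace.proj j : E3 →L[ℝ] ℝ) x :=
    (EuclideanSpace.proj j : E3 →L[ℝ] ℝ).hasFDerivAt
  simp [pd, this.fderiv, PiLp.single_apply, eq_comm]

theorem pd_fun_mul {u v : E3 → ℝ} {x : E3} (hu : DifferentiableAt ℝ u x)
    (hv : DifferentiableAt ℝ v x) (i : Fin 3) :
    pd i (fun x => u x * v x) x = pd i u x * v x + u x * pd i v x := by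
  simp [pd, fderiv_fun_mul hu hv]
  ring

theorem pd_fun_add {u v : E3 → ℝ} {x : E3} (hu : DifferentiableAt ℝ u x)
    (hv : DifferentiableAt ℝ v x) (i : Fin 3) :
    pd i (fun x => u x + v x) x = pd i u x + pd i v x := by
  simp [pd, fderiv_fun_add hu hv]

theorem pd_fun_pow {u : E3 → ℝ} {x : E3} (hu : DifferentiableAt ℝ u x) (n : ℕ) (i : Fin 3) :
    pd i (fun x => u x ^ n) x = n * u x ^ (n - 1) * pd i u x := by
  simp [pd, fderiv_fun_pow n hu]

theorem pd_fun_const_mul {u : E3 → ℝ} {x : E3} (hu : DifferentiableAt ℝ u x) (c : ℝ) (i : Fin 3) :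
    pd i (fun x => c * u x) x = c * pd i u x := by
  simp [pd, fderiv_const_mul hu]

/-! ### The graph function and its derivatives -/

noncomputable section

/-- The numerator of `graphFunction`, as `graphFunction x = graphNum x * |x|^(-23/3)`. -/
def graphNum (x : E3) : ℝ := x 0 * x 1 ^ 3 * (∑ m, x m ^ 2) ^ 2

/-- The gradient of the polynomial `x⁰ (x¹)³`. -/
def quarticGrad (i : Fin 3) (x : E3) : ℝ := ![x 1 ^ 3, 3 * x 0 * x 1 ^ 2, 0] i

/-- The Hessian of the polynomial `x⁰ (x¹)³`. -/
def quarticHess (i j : Fin 3) (x : E3) : ℝ :=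
  !![0, 3 * x 1 ^ 2, 0; 3 * x 1 ^ 2, 6 * x 0 * x 1, 0; 0, 0, 0] i j

/-- The numerator of `∂ᵢ graphFunction` over `|x|^(-23/3)`. -/
def graphGradNum (i : Fin 3) (x : E3) : ℝ :=
  quarticGrad i x * (∑ m, x m ^ 2) ^ 2 - 11 / 3 * (x 0 * x 1 ^ 3) * x i * ∑ m, x m ^ 2

/-- The numerator of `∂ᵢ ∂ⱼ graphFunction` over `|x|^(-23/3)`. -/
def graphHessNum (i j : Fin 3) (x : E3) : ℝ :=
  quarticHess i j x * (∑ m, x m ^ 2) ^ 2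
    - 11 / 3 * (quarticGrad i x * x j + quarticGrad j x * x i
      + x 0 * x 1 ^ 3 * if i = j then 1 else 0) * (∑ m, x m ^ 2)
    + 11 / 3 * (17 / 3) * (x 0 * x 1 ^ 3) * x i * x j

end

variable {x : E3}

/-- Brings f, ∇f and Hess f over the common factor |x|^(-23/3), the lowest power in the Hessian.
Relations among them then become polynomial identities. -/
theorem norm_rpow_eq_sum_sq_mul (hx : x ≠ 0) (a : ℝ) :
    ‖x‖ ^ a = (∑ m, x m ^ 2) * ‖x‖ ^ (a - 2) := by
  have h : ∑ m, x m ^ 2 = ‖x‖ ^ (2 : ℝ) := by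
    rw [Real.rpow_ofNat, EuclideanSpace.norm_sq_eq]
    simp
  rw [h, ← Real.rpow_add (norm_pos_iff.2 hx)]
  congr 1
  ring

theorem graphFunction_eq_quartic_mul (hx : x ≠ 0) :
    graphFunction x = x 0 * x 1 ^ 3 * ‖x‖ ^ (-(11 / 3) : ℝ) := by
  have h0 : 0 < ‖x‖ := norm_pos_iff.2 hx
  have h : ‖x‖ ^ (-(11 / 3) : ℝ) = ‖x‖ ^ (1 / 3 : ℝ) / ‖x‖ ^ 4 := by
    rw [← Real.rpow_natCast, ← Real.rpow_sub h0]
    norm_num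
  rw [graphFunction, h]
  field_simp

theorem graphFunction_eventuallyEq (hx : x ≠ 0) :
    graphFunction =ᶠ[𝓝 x] fun x => x 0 * x 1 ^ 3 * ‖x‖ ^ (-(11 / 3) : ℝ) :=
  (eventually_ne_nhds hx).mono fun _ hy => graphFunction_eq_quartic_mul hy

theorem differentiableAt_norm_rpow (hx : x ≠ 0) (a : ℝ) :
    DifferentiableAt ℝ (fun x : E3 => ‖x‖ ^ a) x :=
  (hasFDerivAt_norm_rpow_of_ne_zero a hx).differentiableAt

theorem pd_quartic (i : Fin 3) (x : E3) : pd i (fun x => x 0 * x 1 ^ 3) x = quarticGrad i x := by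
  rw [pd_fun_mul (by fun_prop) (by fun_prop), pd_fun_pow (by fun_prop), pd_coord, pd_coord]
  fin_cases i <;> simp [quarticGrad]
  ring

theorem differentiableAt_quarticGrad (i : Fin 3) (x : E3) :
    DifferentiableAt ℝ (quarticGrad i) x := by
  have h0 : quarticGrad 0 = fun x => x 1 ^ 3 := rfl
  have h1 : quarticGrad 1 = fun x => 3 * x 0 * x 1 ^ 2 := rfl
  have h2 : quarticGrad 2 = fun x => 0 := rfl
  fin_cases i <;> simp only [Fin.zero_eta, Fin.mk_one, Fin.reduceFinMk, h0, h1, h2] <;> fun_prop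

theorem pd_quarticGrad (i j : Fin 3) (x : E3) : pd i (quarticGrad j) x = quarticHess i j x := by
  have h0 : quarticGrad 0 = fun x => x 1 ^ 3 := rfl
  have h1 : quarticGrad 1 = fun x => 3 * x 0 * x 1 ^ 2 := rfl
  have h2 : quarticGrad 2 = fun x => 0 := rfl
  fin_cases j
  · simp only [Fin.zero_eta, h0]
    rw [pd_fun_pow (by fun_prop), pd_coord]
    fin_cases i <;> simp [quarticHess]
  · simp only [Fin.mk_one, h1]
    rw [pd_fun_mul (by fun_prop) (by fun_prop), pd_fun_pow (by fun_prop),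
      pd_fun_const_mul (by fun_prop), pd_coord, pd_coord]
    fin_cases i <;> simp [quarticHess]
    ring
  · have : pd i (quarticGrad 2) x = 0 := by simp [h2, pd]
    simp only [Fin.reduceFinMk, this]
    fin_cases i <;> simp [quarticHess]

theorem graphFunction_eq (hx : x ≠ 0) :
    graphFunction x = graphNum x * ‖x‖ ^ (-(23 / 3) : ℝ) := by
  rw [graphFunction_eq_quartic_mul hx, norm_rpow_eq_sum_sq_mul hx (-(11 / 3)),
    norm_rpow_eq_sum_sq_mul hx (-(11 / 3) - 2), graphNum]
  norm_num
  ring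

theorem pd_graphFunction_eq_quarticGrad (hx : x ≠ 0) (i : Fin 3) :
    pd i graphFunction x = quarticGrad i x * ‖x‖ ^ (-(11 / 3) : ℝ)
      + -(11 / 3) * (x 0 * x 1 ^ 3) * x i * ‖x‖ ^ (-(17 / 3) : ℝ) := by
  rw [pd, (graphFunction_eventuallyEq hx).fderiv_eq]
  change pd i (fun x => x 0 * x 1 ^ 3 * ‖x‖ ^ (-(11 / 3) : ℝ)) x = _
  rw [pd_fun_mul (by fun_prop) (differentiableAt_norm_rpow hx _), pd_norm_rpow _ _ hx,
    pd_quartic]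
  norm_num
  ring

theorem pd_graphFunction (hx : x ≠ 0) (i : Fin 3) :
    pd i graphFunction x = graphGradNum i x * ‖x‖ ^ (-(23 / 3) : ℝ) := by
  rw [pd_graphFunction_eq_quarticGrad hx, norm_rpow_eq_sum_sq_mul hx (-(11 / 3)),
    norm_rpow_eq_sum_sq_mul hx (-(11 / 3) - 2), norm_rpow_eq_sum_sq_mul hx (-(17 / 3)),
    graphGradNum]
  norm_num
  ring

theorem pd_pd_graphFunction (hx : x ≠ 0) (i j : Fin 3) :
    pd i (pd j graphFunction) x = graphHessNum i j x * ‖x‖ ^ (-(23 / 3) : ℝ) := by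
  have h : pd j graphFunction =ᶠ[𝓝 x] fun x => quarticGrad j x * ‖x‖ ^ (-(11 / 3) : ℝ)
      + -(11 / 3) * (x 0 * x 1 ^ 3) * x j * ‖x‖ ^ (-(17 / 3) : ℝ) :=
    (eventually_ne_nhds hx).mono fun _ hy => pd_graphFunction_eq_quarticGrad hy j
  rw [pd, h.fderiv_eq]
  change pd i (fun x => quarticGrad j x * ‖x‖ ^ (-(11 / 3) : ℝ)
      + -(11 / 3) * (x 0 * x 1 ^ 3) * x j * ‖x‖ ^ (-(17 / 3) : ℝ)) x = _
  have hd1 := differentiableAt_norm_rpow hx (-(11 / 3))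
  have hd2 := differentiableAt_norm_rpow hx (-(17 / 3))
  have hd3 := differentiableAt_quarticGrad j x
  have hd4 : DifferentiableAt ℝ (fun x : E3 => -(11 / 3) * (x 0 * x 1 ^ 3)) x := by fun_prop
  have hd5 : DifferentiableAt ℝ (fun x : E3 => -(11 / 3) * (x 0 * x 1 ^ 3) * x j) x := by fun_prop
  have hd6 : DifferentiableAt ℝ (fun x : E3 => x 0 * x 1 ^ 3) x := by fun_prop
  have hd7 : DifferentiableAt ℝ (fun x : E3 => x j) x := by fun_prop
  rw [pd_fun_add (hd3.fun_mul hd1) (hd5.fun_mul hd2), pd_fun_mul hd3 hd1, pd_fun_mul hd5 hd2,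
    pd_fun_mul hd4 hd7, pd_fun_const_mul hd6, pd_quartic, pd_quarticGrad, pd_coord,
    pd_norm_rpow _ _ hx, pd_norm_rpow _ _ hx, norm_rpow_eq_sum_sq_mul hx (-(11 / 3)),
    norm_rpow_eq_sum_sq_mul hx (-(11 / 3) - 2), norm_rpow_eq_sum_sq_mul hx (-(17 / 3)),
    graphHessNum]
  norm_num
  split_ifs <;> ring

theorem isSymbol_graphFunction (n : ℕ) : IsSymbol n (1 / 3) graphFunction := by
  have h1 := IsSymbol.coord (n := n) 1
  refine (((IsSymbol.coord 0).mul (((h1.mul h1 (c := 2) (by norm_num)).mul h1 (c := 3)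
    (by norm_num))) (c := 4) (by norm_num)).mul (IsSymbol.norm_rpow n (-(11 / 3)))
    (by norm_num)).congr ?_
  filter_upwards [eventually_ne_zero] with x hx
  rw [graphFunction_eq_quartic_mul hx]
  ring

theorem contDiffAt_graphFunction (hx : x ≠ 0) : ContDiffAt ℝ ∞ graphFunction x := by
  refine ContDiffAt.congr_of_eventuallyEq ?_ (graphFunction_eventuallyEq hx)
  have h1 : ContDiffAt ℝ ∞ (fun x : E3 => ‖x‖ ^ (-(11 / 3) : ℝ)) x :=
    (contDiffAt_norm ℝ hx).rpow_const_of_ne (norm_ne_zero_iff.2 hx)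
  exact ContDiffAt.mul (by fun_prop) h1

theorem graphFunction_neg (x : E3) : graphFunction (-x) = graphFunction x := by
  simp only [graphFunction, norm_neg, PiLp.neg_apply]
  ring

/-! ### Existence of admissible graphs -/

theorem exists_isSpacelikeGraph_lt_norm :
    ∃ R : ℝ, 0 < R ∧ IsSpacelikeGraph {x : E3 | R < ‖x‖} graphFunction := by
  obtain ⟨R, hR, h⟩ := exists_forall_lt_norm (eventually_sum_sq_le isSymbol_graphFunction)
  refine ⟨R, hR, .of_sum_sq_lt_one (isOpen_lt continuous_const continuous_norm) ?_ ?_⟩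
  · exact fun x hx => (contDiffAt_graphFunction
      (norm_pos_iff.1 (hR.trans hx))).contDiffWithinAt
  · exact fun x hx => (h x hx).trans_lt one_half_lt_one

theorem graphFunction_smul {r : ℝ} (hr : 0 < r) (x : E3) :
    graphFunction (r • x) = r ^ (1 / 3 : ℝ) * graphFunction x := by
  simp only [graphFunction, norm_smul, Real.norm_of_nonneg hr.le, PiLp.smul_apply, smul_eq_mul]
  rw [Real.mul_rpow hr.le (norm_nonneg x), mul_div_mul_left _ _ hr.ne',
    mul_div_mul_left _ _ hr.ne']
  ring

theorem exists_contDiff_eventuallyEq_graphFunction :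
    ∃ G : E3 → ℝ, ContDiff ℝ ∞ G ∧ G =ᶠ[cobounded E3] graphFunction := by
  -- The cutoff vanishes on the unit ball and equals 1 once |x|² ≥ 2.
  refine ⟨fun x => Real.smoothTransition (‖x‖ ^ 2 - 1) * graphFunction x, ?_, ?_⟩
  · refine contDiff_iff_contDiffAt.2 fun x => ?_
    by_cases hx : x = 0
    · have : (fun x : E3 => Real.smoothTransition (‖x‖ ^ 2 - 1) * graphFunction x) =ᶠ[𝓝 x]
          fun _ => 0 := by
        filter_upwards [Metric.ball_mem_nhds x one_pos] with y hy
        rw [hx, mem_ball_zero_iff] at hy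
        rw [Real.smoothTransition.zero_of_nonpos (by nlinarith [norm_nonneg y]), zero_mul]
      exact contDiffAt_const.congr_of_eventuallyEq this
    · exact (Real.smoothTransition.contDiff.contDiffAt.comp x
        ((contDiff_norm_sq ℝ).sub contDiff_const).contDiffAt).mul (contDiffAt_graphFunction hx)
  · filter_upwards [eventually_lt_norm 2] with x hx
    rw [Real.smoothTransition.one_of_one_le (by nlinarith), one_mul]

/-- The rescaling ρ^(1/3) G(x/ρ) fixes f by homogeneity, so it keeps the behaviour at infinity,
while it multiplies the bounded gradient of G by ρ^(-2/3). Large ρ makes the graph spacelike. -/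
theorem exists_isSpacelikeGraph_univ :
    ∃ F : E3 → ℝ, IsSpacelikeGraph univ F ∧ F =ᶠ[cobounded E3] graphFunction := by
  obtain ⟨G, hG, hGf⟩ := exists_contDiff_eventuallyEq_graphFunction
  have hs : ∀ n, IsSymbol n (1 / 3) G := fun n => (isSymbol_graphFunction n).congr hGf.symm
  obtain ⟨R, hR, hGR⟩ := exists_forall_lt_norm (eventually_sum_sq_le hs)
  have hpd : ∀ i, ContDiffOn ℝ ∞ (pd i G) univ := fun i => hG.contDiffOn.pd isOpen_univ i
  have hcont : Continuous fun x => ∑ i, pd i G x ^ 2 :=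
    continuous_finsetSum _ fun i _ => (continuousOn_univ.1 (hpd i).continuousOn).pow 2
  obtain ⟨M, hM⟩ := (isCompact_closedBall (0 : E3) R).bddAbove_image hcont.continuousOn
  have hM' : ∀ x, ∑ i, pd i G x ^ 2 ≤ max M 1 := fun x => by
    rcases le_or_gt ‖x‖ R with h | h
    · exact (hM (mem_image_of_mem _ (by simpa using h))).trans (le_max_left _ _)
    · exact ((hGR x h).trans (by norm_num)).trans (le_max_right _ _)
  obtain ⟨ρ, hρ, hρM⟩ : ∃ ρ : ℝ, 0 < ρ ∧ (ρ ^ (1 / 3 : ℝ) * ρ⁻¹) ^ 2 * max M 1 < 1 := by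
    have h1 : Tendsto (fun ρ : ℝ => (ρ ^ (-(2 / 3) : ℝ)) ^ 2 * max M 1) atTop
        (𝓝 (0 ^ 2 * max M 1)) :=
      ((tendsto_rpow_neg_atTop (by norm_num)).pow 2).mul_const _
    obtain ⟨ρ, h2, h3⟩ := ((h1.eventually
      (Iio_mem_nhds (by norm_num : (0 : ℝ) ^ 2 * max M 1 < 1))).and
      (eventually_gt_atTop 0)).exists
    refine ⟨ρ, h3, ?_⟩
    rw [← Real.rpow_neg_one, ← Real.rpow_add h3]
    norm_num at h2 ⊢
    exact h2
  have hF : ∀ i x, pd i (fun x => ρ ^ (1 / 3 : ℝ) * G (ρ⁻¹ • x)) x =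
      ρ ^ (1 / 3 : ℝ) * ρ⁻¹ * pd i G (ρ⁻¹ • x) := fun i x => by
    have hGd : Differentiable ℝ G := hG.differentiable (by simp)
    rw [pd_fun_const_mul (u := fun x => G (ρ⁻¹ • x)) (by fun_prop), pd, fderiv_comp_smul]
    simp [pd]
    ring
  refine ⟨fun x => ρ ^ (1 / 3 : ℝ) * G (ρ⁻¹ • x), .of_sum_sq_lt_one isOpen_univ ?_ ?_, ?_⟩
  · have : ContDiff ℝ ∞ fun x : E3 => G (ρ⁻¹ • x) := hG.comp (contDiff_const_smul _)
    exact (contDiff_const.mul this).contDiffOn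
  · intro x _
    simp only [hF, mul_pow _ (pd _ G _), ← Finset.mul_sum]
    exact (mul_le_mul_of_nonneg_left (hM' _) (by positivity)).trans_lt hρM
  · obtain ⟨R', hR', hGR'⟩ := exists_forall_lt_norm hGf
    filter_upwards [eventually_lt_norm (R' * ρ)] with x hx
    have h1 : R' < ‖ρ⁻¹ • x‖ := by
      rw [norm_smul, norm_inv, Real.norm_of_nonneg hρ.le, inv_mul_eq_div, lt_div_iff₀ hρ]
      exact hx
    rw [hGR' _ h1, ← graphFunction_smul hρ, smul_inv_smul₀ hρ.ne']

end

/-! ### Limits of sphere integrals -/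

theorem eventually_smul_sphere {p : E3 → Prop} (h : ∀ᶠ x in cobounded E3, p x) :
    ∀ᶠ r : ℝ in atTop, ∀ v : Metric.sphere (0 : E3) 1, p (r • (v : E3)) := by
  obtain ⟨R, hR, hp⟩ := exists_forall_lt_norm h
  filter_upwards [eventually_gt_atTop R] with r hr v
  exact hp _ (by simpa [norm_smul, abs_of_pos (hR.trans hr)] using hr)

theorem integrable_sphere {φ : Metric.sphere (0 : E3) 1 → ℝ} (hφ : Continuous φ) :
    Integrable φ (volume : Measure E3).toSphere :=
  hφ.integrable_of_hasCompactSupport (HasCompactSupport.of_compactSpace _)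

theorem tendsto_sphereIntegral_of_isBigO {u : E3 → ℝ} {a : ℝ} (ha : a < -2)
    (hu : u =O[cobounded E3] fun x => ‖x‖ ^ a) :
    Tendsto (fun r => sphereIntegral r u) atTop (𝓝 0) := by
  obtain ⟨C, hC⟩ := hu.bound
  set A := (volume : Measure E3).toSphere.real univ
  have h1 : Tendsto (fun r : ℝ => C * r ^ (-(-(a + 2))) * A) atTop (𝓝 (C * 0 * A)) :=
    ((tendsto_rpow_neg_atTop (by linarith)).const_mul C).mul_const A
  rw [mul_zero, zero_mul] at h1
  refine squeeze_zero_norm' ?_ h1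
  filter_upwards [eventually_smul_sphere hC, eventually_gt_atTop 0] with r hr h0
  have h2 := norm_integral_le_of_norm_le_const (μ := (volume : Measure E3).toSphere)
    (f := fun v => u (r • (v : E3))) (C := C * r ^ a) (.of_forall fun v => by
      have := hr v
      simpa [norm_smul, abs_of_pos h0, abs_of_pos (Real.rpow_pos_of_pos h0 a)] using this)
  rw [sphereIntegral, norm_mul, Real.norm_of_nonneg (by positivity)]
  refine (mul_le_mul_of_nonneg_left h2 (by positivity)).trans (le_of_eq ?_)
  rw [neg_neg, Real.rpow_add h0, Real.rpow_ofNat]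
  ring

/-- Isolates a main term with exactly known sphere integrals. Continuity only serves to make both
integrands integrable, so that the integral of the difference splits. -/
theorem tendsto_sphereIntegral_of_sub_isBigO {u w : E3 → ℝ} {a c : ℝ} (ha : a < -2)
    (hu : ∀ᶠ x in cobounded E3, ContinuousAt u x) (hw : ∀ᶠ x in cobounded E3, ContinuousAt w x)
    (huw : (fun x => u x - w x) =O[cobounded E3] fun x => ‖x‖ ^ a)
    (hc : ∀ᶠ r in atTop, sphereIntegral r w = c) :
    Tendsto (fun r => sphereIntegral r u) atTop (𝓝 c) := by
  have h := (tendsto_sphereIntegral_of_isBigO ha huw).add_const c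
  rw [zero_add] at h
  refine h.congr' ?_
  filter_upwards [hc, eventually_smul_sphere hu, eventually_smul_sphere hw] with r hr h1 h2
  have hi : ∀ {f : E3 → ℝ}, (∀ v : Metric.sphere (0 : E3) 1, ContinuousAt f (r • (v : E3))) →
      Integrable (fun v : Metric.sphere (0 : E3) 1 => f (r • (v : E3)))
        (volume : Measure E3).toSphere := fun hf =>
    integrable_sphere (continuous_iff_continuousAt.2 fun v =>
      (hf v).comp (f := fun v : Metric.sphere (0 : E3) 1 => r • (v : E3))
        (Continuous.continuousAt (by fun_prop)))
  rw [← hr, sphereIntegral, sphereIntegral, sphereIntegral, ← mul_add,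
    integral_sub (hi h1) (hi h2), sub_add_cancel]

theorem eventually_neg {p : E3 → Prop} (h : ∀ᶠ x in cobounded E3, p x) :
    ∀ᶠ x in cobounded E3, p (-x) := by
  obtain ⟨R, -, hp⟩ := exists_forall_lt_norm h
  filter_upwards [eventually_lt_norm R] with x hx
  exact hp _ (by rwa [norm_neg])

theorem tendsto_sphereIntegral_of_odd {u : E3 → ℝ} (h : ∀ᶠ x in cobounded E3, u (-x) = -u x) :
    Tendsto (fun r => sphereIntegral r u) atTop (𝓝 0) := by
  refine tendsto_const_nhds.congr' ?_
  obtain ⟨R, hR, hp⟩ := exists_forall_lt_norm h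
  filter_upwards [eventually_gt_atTop R] with r hr
  rw [sphereIntegral, integral_sphere_eq_zero_of_odd (fun x => u (r • x)), mul_zero]
  intro v hv
  rw [smul_neg, hp]
  rwa [norm_smul, hv, mul_one, Real.norm_of_nonneg (hR.trans hr).le]

/-! ### Parity -/

theorem pd_neg_of_even {u : E3 → ℝ} (h : ∀ᶠ x in cobounded E3, u (-x) = u x) (i : Fin 3) :
    ∀ᶠ x in cobounded E3, pd i u (-x) = -pd i u x := by
  filter_upwards [eventually_nhds_of_cobounded h] with x hx
  have h1 : (fun y => u (-y)) =ᶠ[𝓝 x] u := hx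
  have h2 := h1.fderiv_eq (𝕜 := ℝ)
  rw [show (fun y => u (-y)) = fun y => u ((-1 : ℝ) • y) by simp, fderiv_comp_smul] at h2
  rw [pd, pd, ← h2]
  simp

theorem pd_neg_of_odd {u : E3 → ℝ} (h : ∀ᶠ x in cobounded E3, u (-x) = -u x) (i : Fin 3) :
    ∀ᶠ x in cobounded E3, pd i u (-x) = pd i u x := by
  filter_upwards [eventually_nhds_of_cobounded h] with x hx
  have h1 : (fun y => u (-y)) =ᶠ[𝓝 x] fun y => -u y := hx
  have h2 := h1.fderiv_eq (𝕜 := ℝ)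
  rw [show (fun y => u (-y)) = fun y => u ((-1 : ℝ) • y) by simp, fderiv_comp_smul,
    fderiv_fun_neg] at h2
  have h3 : fderiv ℝ u (-x) = fderiv ℝ u x := by simpa using h2
  rw [pd, pd, h3]

/-- An even g has odd derivatives, and the integrand then has odd parity term by term. No decay is
involved. -/
theorem HasCenterOfMass.of_even {g : TensorField2} (hg : ∀ᶠ x in cobounded E3, g (-x) = g x)
    (i : Fin 3) : HasCenterOfMass g i 0 := by
  rw [HasCenterOfMass, ← mul_zero (1 / (16 * Real.pi))]
  refine (tendsto_sphereIntegral_of_odd ?_).const_mul _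
  have h : ∀ᶠ x in cobounded E3, ∀ k a b, pd k (fun y => g y a b) (-x) =
      -pd k (fun y => g y a b) x :=
    eventually_all.2 fun k => eventually_all.2 fun a => eventually_all.2 fun b =>
      pd_neg_of_even (u := fun y => g y a b) (hg.mono fun x hx => by rw [hx]) k
  filter_upwards [hg, h] with x h1 h2
  simp only [h1, h2, norm_neg, PiLp.neg_apply, Fin.sum_univ_three]
  ring

theorem conjugateMomentum_neg_of_even {g k : TensorField2} {x : E3} (hg : g (-x) = g x)
    (hk : k (-x) = k x) : conjugateMomentum g k (-x) = conjugateMomentum g k x := by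
  simp [conjugateMomentum, metricTrace, hg, hk]

theorem HasADMMomentum.of_even {g k : TensorField2} (hg : ∀ᶠ x in cobounded E3, g (-x) = g x)
    (hk : ∀ᶠ x in cobounded E3, k (-x) = k x) (i : Fin 3) : HasADMMomentum g k i 0 := by
  rw [HasADMMomentum, ← mul_zero (1 / (8 * Real.pi))]
  refine (tendsto_sphereIntegral_of_odd ?_).const_mul _
  filter_upwards [hg, hk] with x h1 h2
  simp only [conjugateMomentum_neg_of_even h1 h2, norm_neg, PiLp.neg_apply, Fin.sum_univ_three]
  ring

section Parity

variable {F : E3 → ℝ} (hd : ∀ᶠ x in cobounded E3, ContDiffAt ℝ ∞ F x)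
  (he : ∀ᶠ x in cobounded E3, F (-x) = F x)

include hd he

theorem inducedMetric_neg : ∀ᶠ x in cobounded E3, inducedMetric F (-x) = inducedMetric F x := by
  filter_upwards [hd, eventually_neg hd, eventually_all.2 (pd_neg_of_even he)] with x h1 h2 h3
  ext i j
  rw [inducedMetric_apply (h1.differentiableAt (by simp)),
    inducedMetric_apply (h2.differentiableAt (by simp)), h3, h3]
  ring

theorem secondFundamentalForm_neg :
    ∀ᶠ x in cobounded E3, secondFundamentalForm F (-x) = secondFundamentalForm F x := by
  filter_upwards [hd, eventually_neg hd, eventually_all.2 (pd_neg_of_even he),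
    eventually_all.2 fun i => eventually_all.2 (pd_neg_of_odd (pd_neg_of_even he i))]
    with x h1 h2 h3 h4
  ext i j
  rw [secondFundamentalForm_apply (contDiffAt_infty.1 h1 2),
    secondFundamentalForm_apply (contDiffAt_infty.1 h2 2), h4]
  simp [lorentzFactor, h3]

end Parity

/-! ### Vanishing ADM energy and asymptotic flatness -/

theorem isSymbol_coord_div_norm (n : ℕ) (i : Fin 3) : IsSymbol n 0 (fun x => x i / ‖x‖) := by
  refine ((IsSymbol.coord i).mul (IsSymbol.norm_rpow n (-1)) (by norm_num)).congr
    (.of_forall fun x => ?_)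
  simp only [Real.rpow_neg_one, div_eq_mul_inv]

section Decay

variable {F : E3 → ℝ} (hs : ∀ n, IsSymbol n (1 / 3) F)
  (hd : ∀ᶠ x in cobounded E3, ContDiffAt ℝ ∞ F x)

include hs

theorem hasADMEnergy_zero : HasADMEnergy (inducedMetric F) 0 := by
  rw [HasADMEnergy, ← mul_zero (1 / (16 * Real.pi))]
  refine (tendsto_sphereIntegral_of_isBigO (a := -(7 / 3)) (by norm_num)
    (IsSymbol.isBigO (n := 0) ?_)).const_mul _
  exact IsSymbol.sum _ fun j _ => IsSymbol.sum _ fun k _ =>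
    ((isSymbol_pd_inducedMetric hs 0 k j k).sub (isSymbol_pd_inducedMetric hs 0 j k k)).mul
      (isSymbol_coord_div_norm 0 j) (by norm_num)

include hd

theorem isSymbol_conjugateMomentum (n : ℕ) (i j : Fin 3) : IsSymbol n (-(5 / 3))
    (fun x => conjugateMomentum (inducedMetric F) (secondFundamentalForm F) x i j) := by
  have hg : IsSymbol n 0 (fun x => inducedMetric F x i j) := by
    simpa using ((isSymbol_inducedMetric_sub hs n i j).of_le (b := 0) (by norm_num)).add
      (IsSymbol.const (if i = j then 1 else 0))
  exact (isSymbol_secondFundamentalForm hs hd n i j).sub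
    ((isSymbol_metricTrace hs hd n).mul hg (by norm_num))

theorem isAsymptoticallyFlat_of_isSymbol {Ω : Set E3} (hΩ : IsExteriorRegion Ω)
    (hF : IsSpacelikeGraph Ω F) :
    IsAsymptoticallyFlat Ω (inducedMetric F) (secondFundamentalForm F) := by
  refine ⟨hF.isInitialDataSet, hΩ.exists_isCompact, 4 / 3, 5 / 3, 1 / 3, by norm_num, by norm_num,
    by norm_num, fun i j => (isSymbol_inducedMetric_sub hs 2 i j).isBigOWithDerivs_two,
    fun i j => (isSymbol_secondFundamentalForm hs hd 1 i j).isBigOWithDerivs_one,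
    ((isSymbol_massDensity hs hd 0).isBigO).trans (isBigO_rpow_of_le (by norm_num)),
    (isBigO_currentDensityNorm hs hd).trans (isBigO_rpow_of_le (by norm_num))⟩

end Decay

/-! ### The angular momentum -/

/-- Euler relation for the degree 1/3 of f, after cancelling |x|^(-23/3); the next lemma is the one
for ∇f, of degree -2/3. -/
theorem sum_coord_mul_graphGradNum (x : E3) : ∑ l, x l * graphGradNum l x = 1 / 3 * graphNum x := by
  simp only [graphGradNum, graphNum, quarticGrad, Fin.sum_univ_three, Matrix.cons_val]
  ring

theorem sum_coord_mul_graphHessNum (x : E3) (j : Fin 3) :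
    ∑ l, x l * graphHessNum j l x = -(2 / 3) * graphGradNum j x := by
  fin_cases j <;>
  · simp [graphGradNum, graphHessNum, quarticGrad, quarticHess, Fin.sum_univ_three]
    ring

theorem sum_rotationField_mul (a x : E3) : ∑ j, rotationField a x j * x j = 0 := by
  simp [rotationField, Fin.sum_univ_three]
  ring

theorem isSymbol_rotationField (n : ℕ) (a : E3) (j : Fin 3) :
    IsSymbol n 1 (fun x => rotationField a x j) := by
  have h := fun c i => (IsSymbol.coord (n := n) i).const_mul c
  fin_cases j
  · exact (h (a 1) 2).sub (h (a 2) 1)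
  · exact (h (a 2) 0).sub (h (a 0) 2)
  · exact (h (a 0) 1).sub (h (a 1) 0)

noncomputable section

/-- The numerator of the derivative of `graphFunction` along the rotation field of axis `a`. -/
def rotationGradNum (a x : E3) : ℝ := ∑ j, rotationField a x j * graphGradNum j x

/-- The angular momentum density: the finite part, up to powers of `|x|`. -/
def angularDensityNum (a x : E3) : ℝ :=
  1 / 3 * rotationGradNum a x *
    (graphNum x * (∑ i, graphHessNum i i x) - ∑ i, graphGradNum i x ^ 2)

/-- The part of `π(Y, x / |x|)` which decays no faster than `|x|^(-2)`. -/
def angularMain (a x : E3) : ℝ :=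
  ‖x‖⁻¹ * (-(2 / 3) * (rotationGradNum a x * ‖x‖ ^ (-(23 / 3) : ℝ))
    + angularDensityNum a x * (‖x‖ ^ (-(23 / 3) : ℝ)) ^ 3)

end

theorem continuous_quarticGrad (i : Fin 3) : Continuous (quarticGrad i) :=
  Differentiable.continuous fun x => differentiableAt_quarticGrad i x

theorem continuous_quarticHess (i j : Fin 3) : Continuous (quarticHess i j) := by
  have h0 : Continuous fun _ : E3 => (0 : ℝ) := continuous_const
  have h1 : Continuous fun x : E3 => 3 * x 1 ^ 2 := by fun_prop
  have h2 : Continuous fun x : E3 => 6 * x 0 * x 1 := by fun_prop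
  fin_cases i <;> fin_cases j <;> first | exact h0 | exact h1 | exact h2

theorem continuous_graphGradNum (i : Fin 3) : Continuous (graphGradNum i) := by
  have := continuous_quarticGrad i
  unfold graphGradNum
  fun_prop

theorem continuous_graphHessNum (i j : Fin 3) : Continuous (graphHessNum i j) := by
  have := continuous_quarticGrad i
  have := continuous_quarticGrad j
  have := continuous_quarticHess i j
  unfold graphHessNum
  fun_prop

theorem continuous_rotationField (a : E3) (j : Fin 3) :
    Continuous fun x => rotationField a x j := by
  fin_cases j <;> simp [rotationField] <;> fun_prop

theorem continuous_rotationGradNum (a : E3) : Continuous (rotationGradNum a) :=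
  continuous_finsetSum _ fun j _ => (continuous_rotationField a j).mul (continuous_graphGradNum j)

theorem continuous_angularDensityNum (a : E3) : Continuous (angularDensityNum a) := by
  have h1 := continuous_rotationGradNum a
  have h2 := continuous_graphGradNum
  have h3 := continuous_graphHessNum
  have h4 : Continuous graphNum := by unfold graphNum; fun_prop
  unfold angularDensityNum
  fun_prop

theorem continuousAt_angularMain (a : E3) {x : E3} (hx : x ≠ 0) :
    ContinuousAt (angularMain a) x := by
  have h1 := (continuous_rotationGradNum a).continuousAt (x := x)
  have h2 := (continuous_angularDensityNum a).continuousAt (x := x)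
  have h3 := (differentiableAt_norm_rpow hx (-(23 / 3))).continuousAt
  have h4 : ContinuousAt (fun x : E3 => ‖x‖⁻¹) x :=
    continuous_norm.continuousAt.inv₀ (norm_ne_zero_iff.2 hx)
  unfold angularMain
  fun_prop

theorem rotationGradNum_smul (a x : E3) (r : ℝ) :
    rotationGradNum a (r • x) = r ^ 8 * rotationGradNum a x := by
  simp [rotationGradNum, rotationField, graphGradNum, quarticGrad, Fin.sum_univ_three]
  ring

theorem angularDensityNum_smul (a x : E3) (r : ℝ) :
    angularDensityNum a (r • x) = r ^ 22 * angularDensityNum a x := by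
  have h1 : ∀ i, graphGradNum i (r • x) = r ^ 7 * graphGradNum i x := fun i => by
    fin_cases i <;> simp [graphGradNum, quarticGrad, Fin.sum_univ_three] <;> ring
  have h2 : ∑ i, graphHessNum i i (r • x) = r ^ 6 * ∑ i, graphHessNum i i x := by
    simp [graphHessNum, quarticGrad, quarticHess, Fin.sum_univ_three]
    ring
  have h3 : graphNum (r • x) = r ^ 8 * graphNum x := by
    simp [graphNum, Fin.sum_univ_three]
    ring
  simp only [angularDensityNum, h1, h2, h3, rotationGradNum_smul, Fin.sum_univ_three]
  ring

theorem continuous_sphere_monomial (a b c : ℕ) : Continuous fun v : Metric.sphere (0 : E3) 1 =>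
    (v : E3) 0 ^ a * (v : E3) 1 ^ b * (v : E3) 2 ^ c := by
  fun_prop

theorem sum_sq_sphere (v : Metric.sphere (0 : E3) 1) : ∑ m, (v : E3) m ^ 2 = 1 := by
  have h : ‖(v : E3)‖ ^ 2 = 1 := by simp
  rw [EuclideanSpace.norm_sq_eq] at h
  simpa using h

/-- This removes the part of the angular momentum integral that would grow like r^(4/3).
Conceptually ∫ Yf = 0 by rotation invariance; here the moments 3·⟨x²y²⟩ and ⟨y⁴⟩ cancel and the
others are odd. -/
theorem integral_rotationGradNum (a : E3) :
    ∫ v : Metric.sphere (0 : E3) 1, rotationGradNum a v ∂(volume : Measure E3).toSphere = 0 := by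
  have h : ∀ v : Metric.sphere (0 : E3) 1, rotationGradNum a v =
      a 1 * ((v : E3) 0 ^ 0 * (v : E3) 1 ^ 3 * (v : E3) 2 ^ 1)
      - a 2 * ((v : E3) 0 ^ (2 * 0) * (v : E3) 1 ^ (2 * 2) * (v : E3) 2 ^ (2 * 0))
      + 3 * a 2 * ((v : E3) 0 ^ (2 * 1) * (v : E3) 1 ^ (2 * 1) * (v : E3) 2 ^ (2 * 0))
      - 3 * a 0 * ((v : E3) 0 ^ 1 * (v : E3) 1 ^ 2 * (v : E3) 2 ^ 1) := fun v => by
    simp only [rotationGradNum, graphGradNum, sum_sq_sphere]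
    simp [quarticGrad, rotationField, Fin.sum_univ_three]
    ring
  have hi := fun (c : ℝ) (a b d : ℕ) =>
    (integrable_sphere (continuous_sphere_monomial a b d)).const_mul c
  rw [integral_congr_ae (.of_forall h), integral_sub (((hi _ _ _ _).sub' (hi _ _ _ _)).fun_add
      (hi _ _ _ _)) (hi _ _ _ _), integral_add ((hi _ _ _ _).sub' (hi _ _ _ _)) (hi _ _ _ _),
    integral_sub (hi _ _ _ _) (hi _ _ _ _)]
  simp only [integral_const_mul]
  rw [integral_sphere_monomial_of_odd (a := 0) (b := 3) (c := 1) (by decide),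
    integral_sphere_monomial_of_odd (a := 1) (b := 2) (c := 1) (by decide),
    integral_sphere_monomial_of_even, integral_sphere_monomial_of_even]
  norm_num [Nat.doubleFactorial]
  ring

/-- In units of 4π the four moments are 1/11, 1/231, 1/429 and 1/143. The two of degree 12 cancel,
leaving 1/33 - 1/77 = 4/231. -/
theorem integral_angularDensityNum :
    ∫ v : Metric.sphere (0 : E3) 1, angularDensityNum (EuclideanSpace.single 2 1) v
      ∂(volume : Measure E3).toSphere = 8 * Real.pi * (2 / (3 * 7 * 11)) := by
  have h : ∀ v : Metric.sphere (0 : E3) 1, angularDensityNum (EuclideanSpace.single 2 1) v =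
      1 / 3 * ((v : E3) 0 ^ (2 * 0) * (v : E3) 1 ^ (2 * 5) * (v : E3) 2 ^ (2 * 0))
      - 3 * ((v : E3) 0 ^ (2 * 2) * (v : E3) 1 ^ (2 * 3) * (v : E3) 2 ^ (2 * 0))
      - 11 / 3 * ((v : E3) 0 ^ (2 * 2) * (v : E3) 1 ^ (2 * 4) * (v : E3) 2 ^ (2 * 0))
      + 11 / 9 * ((v : E3) 0 ^ (2 * 1) * (v : E3) 1 ^ (2 * 5) * (v : E3) 2 ^ (2 * 0)) := fun v => by
    have hq := sum_sq_sphere v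
    simp only [angularDensityNum, rotationGradNum, graphNum, graphGradNum, graphHessNum,
      sum_sq_sphere]
    simp [quarticGrad, quarticHess, rotationField, Fin.sum_univ_three] at hq ⊢
    generalize (v : E3) 0 = x at *
    generalize (v : E3) 1 = y at *
    generalize (v : E3) 2 = z at *
    -- The sums ∑ xᵢ² still present come from the trace of the radial Hessian term (187/9) and the
    -- squared radial gradient term (121/9); 22/9 is a third of the difference.
    linear_combination (22 / 9 * (3 * x ^ 2 * y ^ 2 - y ^ 4) * (x * y ^ 3) ^ 2) * hq
  have hi := fun (c : ℝ) (a b d : ℕ) =>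
    (integrable_sphere (continuous_sphere_monomial a b d)).const_mul c
  rw [integral_congr_ae (.of_forall h), integral_add (((hi _ _ _ _).sub' (hi _ _ _ _)).sub'
      (hi _ _ _ _)) (hi _ _ _ _), integral_sub ((hi _ _ _ _).sub' (hi _ _ _ _)) (hi _ _ _ _),
    integral_sub (hi _ _ _ _) (hi _ _ _ _)]
  simp only [integral_const_mul, integral_sphere_monomial_of_even]
  norm_num [Nat.doubleFactorial]
  ring

theorem sphereIntegral_angularMain (a : E3) {r : ℝ} (hr : 0 < r) :
    sphereIntegral r (angularMain a) =
      ∫ v : Metric.sphere (0 : E3) 1, angularDensityNum a v ∂(volume : Measure E3).toSphere := by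
  -- The 23 powers are 2 from the area, -1 from the factor |x|⁻¹, and 22 from the degree of the
  -- density: the main term is scale invariant.
  have ht : r ^ 23 * (r ^ (-(23 / 3) : ℝ)) ^ 3 = 1 := by
    rw [← Real.rpow_natCast, ← Real.rpow_natCast, ← Real.rpow_mul hr.le, ← Real.rpow_add hr]
    norm_num
  have h : ∀ v : Metric.sphere (0 : E3) 1, r ^ 2 * angularMain a (r • (v : E3)) =
      -(2 / 3) * r ^ 9 * r ^ (-(23 / 3) : ℝ) * rotationGradNum a v + angularDensityNum a v :=
    fun v => by
      have hn : ‖r • (v : E3)‖ = r := by simp [norm_smul, abs_of_pos hr]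
      rw [angularMain, hn, rotationGradNum_smul, angularDensityNum_smul]
      field_simp
      linear_combination 3 * angularDensityNum a v * ht
  have h1 : Continuous fun v : Metric.sphere (0 : E3) 1 => rotationGradNum a v :=
    (continuous_rotationGradNum a).comp continuous_subtype_val
  have h2 : Continuous fun v : Metric.sphere (0 : E3) 1 => angularDensityNum a v :=
    (continuous_angularDensityNum a).comp continuous_subtype_val
  rw [sphereIntegral, ← integral_const_mul, integral_congr_ae (.of_forall h),
    integral_add ((integrable_sphere h1).const_mul _) (integrable_sphere h2),
    integral_const_mul, integral_rotationGradNum, mul_zero, zero_add]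

/-- The pairing of `π` with a rotation and the radial direction, for a function
with the Euler relations of a homogeneous function of degree `1/3`. -/
theorem sum_momentum_mul_rotation {γ T ρ f : ℝ} {p x Y : Fin 3 → ℝ} {h : Fin 3 → Fin 3 → ℝ}
    (hYx : ∑ j, Y j * x j = 0) (hp : ∑ l, x l * p l = 1 / 3 * f)
    (hh : ∀ j, ∑ l, x l * h j l = -(2 / 3) * p j) :
    ∑ j, ∑ l, (γ * h j l - T * ((if j = l then 1 else 0) - p j * p l)) * Y j * (x l / ρ) =
      ρ⁻¹ * (-(2 / 3) * γ + T * (1 / 3 * f)) * ∑ j, Y j * p j := by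
  have h0 := hh 0
  have h1 := hh 1
  have h2 := hh 2
  simp [Fin.sum_univ_three, div_eq_mul_inv] at *
  linear_combination ρ⁻¹ * γ * (Y 0 * h0 + Y 1 * h1 + Y 2 * h2) - ρ⁻¹ * T * hYx
    + ρ⁻¹ * T * (Y 0 * p 0 + Y 1 * p 1 + Y 2 * p 2) * hp

theorem metricTrace_eq {F : E3 → ℝ} {x : E3} (hF : ContDiffAt ℝ 2 F x)
    (h : ∑ i, pd i F x ^ 2 < 1) :
    metricTrace (inducedMetric F) (secondFundamentalForm F) x =
      lorentzFactor F x * (∑ i, pd i (pd i F) x + lorentzFactor F x ^ 2 *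
        ∑ i, ∑ j, pd i F x * pd j F x * pd i (pd j F) x) := by
  simp only [metricTrace, inducedMetric_inv_apply (hF.differentiableAt (by simp)) h,
    secondFundamentalForm_apply hF]
  simp [Fin.sum_univ_three]
  ring

/-! ### Expansion of the angular momentum integrand -/

section Angular

variable {F : E3 → ℝ} (hF : F =ᶠ[cobounded E3] graphFunction)

include hF

/-- The main term replaces γ by 1 + |∇F|²/2 and tr_g k by ΔF in the exact formula of
`sum_momentum_mul_rotation`. What remains is the Taylor error of γ and the error of the trace, each
visibly of lower order. -/
theorem angularMomentum_integrand_sub_main (a : E3) :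
    (fun x => (∑ j, ∑ l, conjugateMomentum (inducedMetric F) (secondFundamentalForm F) x j l *
      rotationField a x j * (x l / ‖x‖)) - angularMain a x) =ᶠ[cobounded E3] fun x =>
    ‖x‖ ^ (-1 : ℝ) * (((lorentzFactor F x - 1) * (∑ i, pd i (pd i F) x)
        + lorentzFactor F x * lorentzFactor F x * lorentzFactor F x *
          ∑ i, ∑ j, pd i F x * pd j F x * pd i (pd j F) x) * (1 / 3 * F x)
        + -(2 / 3) * (lorentzFactor F x - 1 - 1 / 2 * ∑ i, pd i F x ^ 2)) *
      ∑ j, rotationField a x j * pd j F x := by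
  have hs : ∀ n, IsSymbol n (1 / 3) F := fun n => (isSymbol_graphFunction n).congr hF.symm
  filter_upwards [eventually_nhds_of_cobounded hF, eventually_all.2 fun i => hF.pd i,
    eventually_all.2 fun i => eventually_all.2 fun j => (hF.pd j).pd i,
    eventually_ne_zero, eventually_sum_sq_le hs] with x hx h1 h2 h0 hle
  have hd : ContDiffAt ℝ 2 F x :=
    (contDiffAt_infty.1 (contDiffAt_graphFunction h0) 2).congr_of_eventuallyEq hx
  have hlt : ∑ i, pd i F x ^ 2 < 1 := by linarith
  set t := ‖x‖ ^ (-(23 / 3) : ℝ) with ht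
  have hf : F x = graphNum x * t := by rw [hx.self_of_nhds, graphFunction_eq h0]
  have hp : ∀ i, pd i F x = graphGradNum i x * t := fun i => by rw [h1, pd_graphFunction h0]
  have hh : ∀ i j, pd i (pd j F) x = graphHessNum i j x * t := fun i j => by
    rw [h2, pd_pd_graphFunction h0]
  have hE1 : ∑ l, x l * pd l F x = 1 / 3 * F x := by
    simp only [hp, hf, ← mul_assoc, ← Finset.sum_mul, sum_coord_mul_graphGradNum]
  have hE2 : ∀ j, ∑ l, x l * pd j (pd l F) x = -(2 / 3) * pd j F x := fun j => by
    simp only [hp, hh, ← mul_assoc, ← Finset.sum_mul, sum_coord_mul_graphHessNum]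
  have hπ : ∀ j l, conjugateMomentum (inducedMetric F) (secondFundamentalForm F) x j l =
      lorentzFactor F x * pd j (pd l F) x -
      metricTrace (inducedMetric F) (secondFundamentalForm F) x *
        ((if j = l then 1 else 0) - pd j F x * pd l F x) := fun j l => by
    rw [conjugateMomentum, Matrix.sub_apply, Matrix.smul_apply, smul_eq_mul,
      secondFundamentalForm_apply hd, inducedMetric_apply (hd.differentiableAt (by simp))]
  simp only [hπ]
  rw [sum_momentum_mul_rotation (sum_rotationField_mul a x) hE1 hE2, metricTrace_eq hd hlt,
    Real.rpow_neg_one]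
  have hm : angularMain a x = ‖x‖⁻¹ * (-(2 / 3) + 1 / 3 * (F x * (∑ i, pd i (pd i F) x)
      - ∑ i, pd i F x ^ 2)) * ∑ j, rotationField a x j * pd j F x := by
    simp only [angularMain, angularDensityNum, rotationGradNum, hf, hp, hh, ← ht, ← mul_assoc,
      mul_pow, ← Finset.sum_mul]
    ring
  rw [hm]
  ring

theorem isBigO_angularMomentum_integrand_sub_main (a : E3) :
    (fun x => (∑ j, ∑ l, conjugateMomentum (inducedMetric F) (secondFundamentalForm F) x j l *
      rotationField a x j * (x l / ‖x‖)) - angularMain a x) =O[cobounded E3]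
    fun x => ‖x‖ ^ (-(10 / 3) : ℝ) := by
  have hs : ∀ n, IsSymbol n (1 / 3) F := fun n => (isSymbol_graphFunction n).congr hF.symm
  refine (isBigO_congr (angularMomentum_integrand_sub_main hF a) .rfl).2 ?_
  have hl := isSymbol_lorentzFactor hs 0
  have hl3 := (hl.mul hl (c := 0) (by norm_num)).mul hl (c := 0) (by norm_num)
  have hΔ : IsSymbol 0 (-(5 / 3)) fun x => ∑ i, pd i (pd i F) x :=
    IsSymbol.sum _ fun i _ => isSymbol_pd_pd hs 0 i i
  have hQ : IsSymbol 0 (-3) fun x => ∑ i, ∑ j, pd i F x * pd j F x * pd i (pd j F) x :=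
    IsSymbol.sum _ fun i _ => IsSymbol.sum _ fun j _ =>
      ((isSymbol_pd hs 0 i).mul (isSymbol_pd hs 0 j) (c := -(4 / 3)) (by norm_num)).mul
        (isSymbol_pd_pd hs 0 i j) (by norm_num)
  have hY : IsSymbol 0 (1 / 3) fun x => ∑ j, rotationField a x j * pd j F x :=
    IsSymbol.sum _ fun j _ => (isSymbol_rotationField 0 a j).mul (isSymbol_pd hs 0 j) (by norm_num)
  have hT : IsSymbol 0 (-(8 / 3)) fun x => lorentzFactor F x - 1 - 1 / 2 * ∑ i, pd i F x ^ 2 :=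
    isBigO_lorentzFactor_sub_taylor hs
  have h1 := ((((isSymbol_lorentzFactor_sub_one hs 0).mul hΔ (c := -3) (by norm_num)).add
    (hl3.mul hQ (c := -3) (by norm_num))).mul ((hs 0).const_mul (1 / 3)) (c := -(8 / 3))
      (by norm_num)).add (hT.const_mul (-(2 / 3)))
  exact (((IsSymbol.norm_rpow 0 (-1)).mul h1 (c := -(11 / 3)) (by norm_num)).mul hY
    (c := -(10 / 3)) (by norm_num)).isBigO

theorem hasADMAngularMomentum_rotationField (a : E3) :
    HasADMAngularMomentum (inducedMetric F) (secondFundamentalForm F) (rotationField a)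
      (1 / (8 * Real.pi) * ∫ v : Metric.sphere (0 : E3) 1, angularDensityNum a v
        ∂(volume : Measure E3).toSphere) := by
  have hs : ∀ n, IsSymbol n (1 / 3) F := fun n => (isSymbol_graphFunction n).congr hF.symm
  have hd : ∀ᶠ x in cobounded E3, ContDiffAt ℝ ∞ F x := by
    filter_upwards [eventually_nhds_of_cobounded hF, eventually_ne_zero] with x hx h0
    exact (contDiffAt_graphFunction h0).congr_of_eventuallyEq hx
  refine Tendsto.const_mul _ (tendsto_sphereIntegral_of_sub_isBigO (by norm_num) ?_
    (eventually_ne_zero.mono fun x hx => continuousAt_angularMain a hx)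
    (isBigO_angularMomentum_integrand_sub_main hF a)
    ((eventually_gt_atTop 0).mono fun r hr => sphereIntegral_angularMain a hr))
  -- Only the differentiability, hence continuity, of the integrand is used; the exponent -2/3 alone
  -- would allow divergence.
  have h : IsSymbol 1 (-(2 / 3)) fun x => ∑ j, ∑ l,
      conjugateMomentum (inducedMetric F) (secondFundamentalForm F) x j l *
        rotationField a x j * (x l / ‖x‖) :=
    IsSymbol.sum _ fun j _ => IsSymbol.sum _ fun l _ =>
      ((isSymbol_conjugateMomentum hs hd 1 j l).mul (isSymbol_rotationField 1 a j)
        (c := -(2 / 3)) (by norm_num)).mul (isSymbol_coord_div_norm 1 l) (by norm_num)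
  exact h.differentiableAt.mono fun x hx => hx.continuousAt

end Angular

theorem mainTheorem2 :
    (∃ F : E3 → ℝ, IsSpacelikeGraph univ F ∧ F =ᶠ[Bornology.cobounded E3] graphFunction) ∧
    (∃ R : ℝ, 0 < R ∧ IsSpacelikeGraph {x : E3 | R < ‖x‖} graphFunction) ∧
    ∀ (Ω : Set E3) (F : E3 → ℝ), IsExteriorRegion Ω → IsSpacelikeGraph Ω F →
      F =ᶠ[Bornology.cobounded E3] graphFunction →
      IsAsymptoticallyFlat Ω (inducedMetric F) (secondFundamentalForm F) ∧
      HasADMEnergy (inducedMetric F) 0 ∧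
      (∀ i : Fin 3, HasADMMomentum (inducedMetric F) (secondFundamentalForm F) i 0) ∧
      (∀ i : Fin 3, HasCenterOfMass (inducedMetric F) i 0) ∧
      (∀ a : E3, ∃ J : ℝ, HasADMAngularMomentum (inducedMetric F) (secondFundamentalForm F)
        (rotationField a) J) ∧
      HasADMAngularMomentum (inducedMetric F) (secondFundamentalForm F)
        (fun x => !₂[-(x 1), x 0, 0]) (2 / (3 * 7 * 11)) := by
  refine ⟨exists_isSpacelikeGraph_univ, exists_isSpacelikeGraph_lt_norm, fun Ω F hΩ hG hF => ?_⟩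
  have hs : ∀ n, IsSymbol n (1 / 3) F := fun n => (isSymbol_graphFunction n).congr hF.symm
  have hd : ∀ᶠ x in cobounded E3, ContDiffAt ℝ ∞ F x :=
    hΩ.eventually_mem.mono fun x hx => hG.contDiffAt hx
  have he : ∀ᶠ x in cobounded E3, F (-x) = F x := by
    filter_upwards [hF, eventually_neg hF] with x h1 h2
    rw [h1, h2, graphFunction_neg]
  have hg := inducedMetric_neg hd he
  have hk := secondFundamentalForm_neg hd he
  refine ⟨isAsymptoticallyFlat_of_isSymbol hs hd hΩ hG, hasADMEnergy_zero hs,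
    HasADMMomentum.of_even hg hk, HasCenterOfMass.of_even hg,
    fun a => ⟨_, hasADMAngularMomentum_rotationField hF a⟩, ?_⟩
  have h := hasADMAngularMomentum_rotationField hF (EuclideanSpace.single 2 1)
  have hY : rotationField (EuclideanSpace.single 2 1) = fun x => !₂[-(x 1), x 0, 0] := by
    funext x
    simp [rotationField]
  rw [integral_angularDensityNum, hY] at h
  convert h using 1
  field_simp
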